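/- Let $d\ge 1$. A $d$-dimensional Fano polyhedron is a convex polytope $P\subset\mathbb R^d$ with vertices in $\mathbb Z^d$ that contains $0$ in its interior and is simplicial (every proper face is a simplex), and such that the vertices of each facet form a $\mathbb Z$-basis of $\mathbb Z^d$. Two such polyhedra are isomorphic if an element of $\mathrm{GL}(d,\mathbb Z)$ maps one onto the other, and combinatorially equivalent if there is a bijection of their vertex sets under which vertex sets of faces that are simplices correspond to each other in both directions. Let $\Sigma(P)$ be the fan consisting of $\{0\}$ and the cones spanned by the vertices of the proper faces of $P$. A set $\mathcal P$ of vertices is a primitive collection if it is contained in no cone of $\Sigma(P)$, but each of its proper subsets is. Its primitive relation is $\sum_{v\in\mathcal P}v=c_1w_1+\dots+c_mw_m$, where $w_1,\dots,w_m$ are the vertices generating the cone of minimal dimension in $\Sigma(P)$ that contains $\sum_{v\in\mathcal P}v$ and the $c_i$ are positive integers (the right side is $0$ if $m=0$). **Theorem.** Up to isomorphism there are exactly $28$ four-dimensional Fano polyhedra with $7$ vertices. They form exactly three combinatorial equivalence classes, the types $D$, $E$, $G$, containing $19$, $3$ and $6$ isomorphism classes respectively. In a suitable numbering $v_1,\dots,v_7$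 of the vertices, the primitive collections are precisely the sets occurring on the left sides below. Each of the following $28$ systems is the complete system of primitive relations of such a polyhedron in a suitable numbering of its vertices; every four-dimensional Fano polyhedron with $7$ vertices is described in this way by exactly one of the systems; and two of these polyhedra are isomorphic if and only if they are described by the same system. (i) Type $D$: the values of $(v_1+v_2+v_3,\ v_4+v_5,\ v_6+v_7)$ are $D_1:(2v_6,v_6,0)$, $D_2:(2v_4,v_6,0)$, $D_3:(v_4+v_6,v_6,0)$, $D_4:(2v_6,v_1,0)$, $D_5:(2v_4,0,0)$, $D_6:(v_6,v_6,0)$, $D_7:(0,v_1,v_1)$, $D_8:(v_4,v_6,0)$, $D_9:(v_4+v_6,0,0)$, $D_{10}:(v_6,v_1,0)$, $D_{11}:(0,v_1,v_4)$, $D_{12}:(v_4,0,0)$, $D_{13}:(0,0,0)$, $D_{14}:(0,0,v_1)$, $D_{15}:(0,0,v_4)$, $D_{16}:(v_4+v_7,v_6,0)$, $D_{17}:(0,v_1,v_2)$, $D_{18}:(2v_7,v_6,0)$, $D_{19}:(v_7,v_6,0)$. (ii) Type $E$: $v_1+v_7=0$, $v_1+v_2=v_6$, $v_6+v_7=v_2$,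 and the values of $(v_2+v_3+v_4+v_5,\ v_3+v_4+v_5+v_6)$ are $E_1:(2v_1,3v_1)$, $E_2:(v_1,2v_1)$, $E_3:(0,v_1)$. (iii) Type $G$: the values of $(v_1+v_7,\ v_2+v_3+v_4,\ v_4+v_5+v_6,\ v_5+v_6+v_7,\ v_1+v_2+v_3)$ are $G_1:(0,v_1,2v_1,v_2+v_3,v_5+v_6)$, $G_2:(v_4,v_7,2v_1,v_1,0)$, $G_3:(0,0,v_1,v_2+v_3,v_5+v_6)$, $G_4:(v_4,v_7,v_1+v_2,v_2,0)$, $G_5:(v_4,v_7,0,v_2+v_3,0)$, $G_6:(v_4,v_7,v_1,0,0)$. -/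

import Mathlib

noncomputable section

namespace FanoClassification

/-- The set of vertices of a convex set (for a polytope: its extreme points). -/
def vertices {d : ℕ} (P : Set (Fin d → ℝ)) : Set (Fin d → ℝ) :=
  P.extremePoints ℝ

/-- The standard lattice `ℤ ^ d` inside `ℝ ^ d`. -/
def stdLattice (d : ℕ) : Submodule ℤ (Fin d → ℝ) :=
  Submodule.span ℤ (Set.range (Pi.basisFun ℝ (Fin d)))

/-- Proper faces of a convex polytope: the sets where a linear functional is maximal on `P`,
other than `P` itself. The empty set counts as a (proper) face. -/
def IsProperFace {d : ℕ} (P F : Set (Fin d → ℝ)) : Prop :=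
  IsExposed ℝ P F ∧ F ≠ P

/-- `F` is a nonempty face of `P` of dimension `k`. -/
def IsFaceOfDim {d : ℕ} (P F : Set (Fin d → ℝ)) (k : ℕ) : Prop :=
  IsExposed ℝ P F ∧ F.Nonempty ∧ Module.finrank ℝ (vectorSpan ℝ F) = k

/-- The elements of `W` form a `ℤ`-basis of the lattice `ℤ ^ d`. -/
def IsLatticeBasis {d : ℕ} (W : Set (Fin d → ℝ)) : Prop :=
  LinearIndependent ℤ (Subtype.val : W → (Fin d → ℝ)) ∧ Submodule.span ℤ W = stdLattice d

/-- `d`-dimensional Fano polyhedra in `ℝ ^ d`. -/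
structure IsFanoPolyhedron {d : ℕ} (P : Set (Fin d → ℝ)) : Prop where
  /-- `P` is a convex polytope. -/
  polytope : ∃ s : Set (Fin d → ℝ), s.Finite ∧ P = convexHull ℝ s
  /-- The vertices are lattice points. -/
  integral : ∀ v ∈ vertices P, v ∈ stdLattice d
  /-- The origin lies in the interior. -/
  zero_mem : (0 : Fin d → ℝ) ∈ interior P
  /-- Every proper face is a simplex. -/
  simplicial : ∀ F, IsProperFace P F →
    AffineIndependent ℝ (Subtype.val : vertices F → (Fin d → ℝ))
  /-- The vertices of every facet form a basis of the lattice. -/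
  unimodular : ∀ F k, k + 1 = d → IsFaceOfDim P F k → IsLatticeBasis (vertices F)

/-- The cone `σ(F)` of all nonnegative combinations of the vertices of `F`. -/
def faceCone {d : ℕ} (F : Set (Fin d → ℝ)) : PointedCone ℝ (Fin d → ℝ) :=
  PointedCone.hull ℝ (vertices F)

/-- The fan `Σ(P)`: all cones `σ(F)` over the proper faces (the empty face contributes `{0}`). -/
def fan {d : ℕ} (P : Set (Fin d → ℝ)) : Set (PointedCone ℝ (Fin d → ℝ)) :=
  {σ | ∃ F, IsProperFace P F ∧ σ = faceCone F}

/-- The dimension of a cone, i.e. of its linear span. -/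
def coneDim {d : ℕ} (σ : PointedCone ℝ (Fin d → ℝ)) : ℕ :=
  Module.finrank ℝ (Submodule.span ℝ (σ : Set (Fin d → ℝ)))

/-- Primitive collections: sets of vertices that lie in no cone of the fan, although each of
their proper subsets does. -/
def IsPrimitiveCollection {d : ℕ} (P : Set (Fin d → ℝ)) (C : Finset (Fin d → ℝ)) : Prop :=
  (C : Set (Fin d → ℝ)) ⊆ vertices P ∧
  (¬ ∃ σ ∈ fan P, (C : Set (Fin d → ℝ)) ⊆ σ) ∧
  ∀ B : Finset (Fin d → ℝ), B ⊂ C → ∃ σ ∈ fan P, (B : Set (Fin d → ℝ)) ⊆ σ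

/-- `C` is a primitive collection of `P` and its primitive relation is
`∑ x ∈ C, x = c₁ w₁ + ⋯ + cₘ wₘ`, where the right side is recorded by the multiset `R` in which
`w₁, …, wₘ` occur with the multiplicities `c₁, …, cₘ`. So `w₁, …, wₘ` are the generators
of the cone of minimal dimension in the fan that contains the sum of `C`. -/
def IsPrimitiveRelation {d : ℕ} (P : Set (Fin d → ℝ)) (C : Finset (Fin d → ℝ))
    (R : Multiset (Fin d → ℝ)) : Prop :=
  IsPrimitiveCollection P C ∧
  ∃ F, IsProperFace P F ∧ ∑ x ∈ C, x ∈ faceCone F ∧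
    (∀ τ ∈ fan P, ∑ x ∈ C, x ∈ τ → coneDim (faceCone F) ≤ coneDim τ) ∧
    {x | x ∈ R} = vertices F ∧
    ∑ x ∈ C, x = R.sum

/-- The `d`-dimensional Fano polyhedra with exactly `n` vertices. -/
def FanoPolyhedron (d n : ℕ) : Type :=
  {P : Set (Fin d → ℝ) // IsFanoPolyhedron P ∧ (vertices P).ncard = n}

/-- The linear action of an integral matrix on `ℝ ^ d`. -/
def act {d : ℕ} (A : Matrix (Fin d) (Fin d) ℤ) (x : Fin d → ℝ) : Fin d → ℝ :=
  (A.map (Int.cast : ℤ → ℝ)).mulVec x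

/-- Isomorphism of Fano polyhedra: some element of `GL(d, ℤ)` maps one onto the other. -/
def Isomorphic {d n : ℕ} (P Q : FanoPolyhedron d n) : Prop :=
  ∃ A : GL (Fin d) ℤ, act A.val '' P.1 = Q.1

theorem act_one {d : ℕ} (x : Fin d → ℝ) : act (1 : Matrix (Fin d) (Fin d) ℤ) x = x := by
  simp [act, Matrix.map_one]

theorem act_mul {d : ℕ} (A B : Matrix (Fin d) (Fin d) ℤ) (x : Fin d → ℝ) :
    act (A * B) x = act A (act B x) := by
  have h : (A * B).map (Int.cast : ℤ → ℝ) = A.map Int.cast * B.map Int.cast :=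
    Matrix.map_mul (f := Int.castRingHom ℝ)
  simp [act, h, Matrix.mulVec_mulVec]

theorem isomorphic_equivalence (d n : ℕ) :
    Equivalence (Isomorphic : FanoPolyhedron d n → FanoPolyhedron d n → Prop) where
  refl P := ⟨1, by simp [act_one]⟩
  symm := by
    rintro P Q ⟨A, hA⟩
    refine ⟨A⁻¹, ?_⟩
    rw [← hA, Set.image_image]
    simp [← act_mul, act_one]
  trans := by
    rintro P Q R ⟨A, hA⟩ ⟨B, hB⟩
    refine ⟨B * A, ?_⟩
    rw [← hB, ← hA, Set.image_image]
    simp [act_mul]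

/-- Isomorphism as an equivalence relation. -/
def isoSetoid (d n : ℕ) : Setoid (FanoPolyhedron d n) :=
  ⟨Isomorphic, isomorphic_equivalence d n⟩

/-- Isomorphism classes of `d`-dimensional Fano polyhedra with `n` vertices. -/
def IsoClass (d n : ℕ) : Type := Quotient (isoSetoid d n)

/-- The isomorphism class of a Fano polyhedron. -/
def FanoPolyhedron.isoClass {d n : ℕ} (P : FanoPolyhedron d n) : IsoClass d n :=
  Quotient.mk (isoSetoid d n) P

/-- `S` is the vertex set of a face of dimension `|S| - 1`. -/
def IsSimplexFace {d : ℕ} (P S : Set (Fin d → ℝ)) : Prop :=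
  ∃ F k, IsFaceOfDim P F k ∧ vertices F = S ∧ k + 1 = S.ncard

/-- Combinatorial equivalence: a bijection of the vertices that respects faces. -/
def CombinatoriallyEquivalent {d n : ℕ} (P Q : FanoPolyhedron d n) : Prop :=
  ∃ ρ : vertices P.1 ≃ vertices Q.1, ∀ S : Set (vertices P.1),
    IsSimplexFace P.1 (Subtype.val '' S) ↔ IsSimplexFace Q.1 (Subtype.val '' (ρ '' S))

/-- The three combinatorial types. -/
inductive CombType
  | D | E | G

/-! The vertices are numbered `1, …, 7`. We use `Fin 7` for the indices, where the
numeral `7` denotes the same element as `0`, so that `1, …, 7` are its seven elements. -/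

/-- The primitive collections of each combinatorial type. -/
def CombType.collections : CombType → List (Finset (Fin 7))
  | .D => [{1, 2, 3}, {4, 5}, {6, 7}]
  | .E => [{1, 7}, {1, 2}, {6, 7}, {2, 3, 4, 5}, {3, 4, 5, 6}]
  | .G => [{1, 7}, {2, 3, 4}, {4, 5, 6}, {5, 6, 7}, {1, 2, 3}]

/-- A numbering of the vertices of `P`. -/
def IsNumbering {d n : ℕ} (P : FanoPolyhedron d n) (v : Fin n ↪ (Fin d → ℝ)) : Prop :=
  Set.range v = vertices P.1

/-- `P` has combinatorial type `t`: for some numbering of the vertices, the primitive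
collections are exactly those of `t`. -/
def HasType (P : FanoPolyhedron 4 7) (t : CombType) : Prop :=
  ∃ v : Fin 7 ↪ (Fin 4 → ℝ), IsNumbering P v ∧
    ∀ S : Finset (Fin 7), IsPrimitiveCollection P.1 (S.map v) ↔ S ∈ t.collections

/-- The names `D₁, …, D₁₉`, `E₁, E₂, E₃`, `G₁, …, G₆`; here `D i` stands for `D_{i+1}` with
`i = 0, …, 18`, and so on. -/
inductive Name
  | D (i : Fin 19)
  | E (i : Fin 3)
  | G (i : Fin 6)

/-- The combinatorial type of a name. -/
def Name.type : Name → CombType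
  | .D _ => .D
  | .E _ => .E
  | .G _ => .G

/-- Right sides of the relations `v₁ + v₂ + v₃ = …`, `v₄ + v₅ = …`, `v₆ + v₇ = …`;
for example `{4, 6}` stands for `v₄ + v₆`, `{6, 6}` for `2 v₆`, and `0` for `0`. -/
def rightD : Fin 19 → Multiset (Fin 7) × Multiset (Fin 7) × Multiset (Fin 7) :=
  ![({6, 6}, {6}, 0),
    ({4, 4}, {6}, 0),
    ({4, 6}, {6}, 0),
    ({6, 6}, {1}, 0),
    ({4, 4}, 0, 0),
    ({6}, {6}, 0),
    (0, {1}, {1}),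
    ({4}, {6}, 0),
    ({4, 6}, 0, 0),
    ({6}, {1}, 0),
    (0, {1}, {4}),
    ({4}, 0, 0),
    (0, 0, 0),
    (0, 0, {1}),
    (0, 0, {4}),
    ({4, 7}, {6}, 0),
    (0, {1}, {2}),
    ({7, 7}, {6}, 0),
    ({7}, {6}, 0)]

/-- Right sides of the relations `v₂ + v₃ + v₄ + v₅ = …` and `v₃ + v₄ + v₅ + v₆ = …`. -/
def rightE : Fin 3 → Multiset (Fin 7) × Multiset (Fin 7) :=
  ![({1, 1}, {1, 1, 1}),
    ({1}, {1, 1}),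
    (0, {1})]

/-- Right sides of the relations `v₁ + v₇ = …`, `v₂ + v₃ + v₄ = …`, `v₄ + v₅ + v₆ = …`,
`v₅ + v₆ + v₇ = …`, `v₁ + v₂ + v₃ = …`. -/
def rightG : Fin 6 → Multiset (Fin 7) × Multiset (Fin 7) × Multiset (Fin 7) ×
    Multiset (Fin 7) × Multiset (Fin 7) :=
  ![(0, {1}, {1, 1}, {2, 3}, {5, 6}),
    ({4}, {7}, {1, 1}, {1}, 0),
    (0, 0, {1}, {2, 3}, {5, 6}),
    ({4}, {7}, {1, 2}, {2}, 0),
    ({4}, {7}, 0, {2, 3}, 0),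
    ({4}, {7}, {1}, 0, 0)]

/-- The list of primitive relations belonging to each name: pairs of a primitive collection
and the right side of its relation. -/
def Name.relations : Name → List (Finset (Fin 7) × Multiset (Fin 7))
  | .D i =>
    [({1, 2, 3}, (rightD i).1), ({4, 5}, (rightD i).2.1), ({6, 7}, (rightD i).2.2)]
  | .E i =>
    [({1, 7}, 0), ({1, 2}, {6}), ({6, 7}, {2}),
     ({2, 3, 4, 5}, (rightE i).1), ({3, 4, 5, 6}, (rightE i).2)]
  | .G i =>
    [({1, 7}, (rightG i).1), ({2, 3, 4}, (rightG i).2.1), ({4, 5, 6}, (rightG i).2.2.1),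
     ({5, 6, 7}, (rightG i).2.2.2.1), ({1, 2, 3}, (rightG i).2.2.2.2)]

/-- `P` is described by the primitive relations belonging to `a`: for some numbering of the
vertices, these are exactly the primitive relations of `P`. -/
def DescribedBy (P : FanoPolyhedron 4 7) (a : Name) : Prop :=
  ∃ v : Fin 7 ↪ (Fin 4 → ℝ), IsNumbering P v ∧
    (∀ S : Finset (Fin 7),
      IsPrimitiveCollection P.1 (S.map v) ↔ ∃ r ∈ a.relations, r.1 = S) ∧
    ∀ r ∈ a.relations, IsPrimitiveRelation P.1 (r.1.map v) (r.2.map v)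

/-- The isomorphism classes of Fano polyhedra of a given combinatorial type. -/
def classesOfType (t : CombType) : Set (IsoClass 4 7) :=
  {q | ∃ P : FanoPolyhedron 4 7, P.isoClass = q ∧ HasType P t}

end FanoClassification

end

/-!
Choose a facet whose cone contains the sum of all seven vertices. Its vertices form a lattice
basis, in which the remaining three vertices are integral points of height (sum of coordinates) at
most `0`, and the choice of the facet makes the sum of the three heights at least `-4`. Across each
ridge of the facet there is a neighboring facet, whose vertices again form a lattice basis. Hence
some remaining vertex has the corresponding coordinate `-1`, and exchanging it for the opposite
vertex gives coordinates with respect to another facet, to which the same applies. This bounds all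
coordinates; a finite enumeration that takes up to three exchanges into account leaves only points
which satisfy one of the 28 systems of relations up to a renumbering.

Conversely, vectors that satisfy one of the systems span a Fano polyhedron. Its facets are
recognized by determinants: those of the facets are `±1`, and the sign of a second determinant says
that every other vertex lies below the facet. The primitive collections are then the minimal sets
which no facet contains.

A polyhedron determines its primitive relations up to renumbering, so a numerical invariant of
systems of relations shows that different systems belong to nonisomorphic polyhedra.
-/

namespace FanoClassification

open Module

section LinearAlgebra

variable {ι K V : Type*} [Field K] [AddCommGroup V] [Module K V]

theorem vectorSpan_eq_ker_of_span_eq_top {S : Set V} {l : V →ₗ[K] K} (hS : S.Nonempty)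
    (hl : ∀ x ∈ S, l x = 1) (hspan : Submodule.span K S = ⊤) :
    vectorSpan K S = LinearMap.ker l := by
  apply le_antisymm
  · rw [vectorSpan_def, Submodule.span_le]
    rintro _ ⟨x, hx, y, hy, rfl⟩
    simp [hl x hx, hl y hy]
  · obtain ⟨x₀, hx₀⟩ := hS
    have hproj : ∀ x, x - l x • x₀ ∈ vectorSpan K S := by
      intro x
      have hx : x ∈ Submodule.span K S := hspan ▸ Submodule.mem_top
      induction hx using Submodule.span_induction with
      | mem x hx =>
        rw [hl x hx, one_smul]
        exact vsub_mem_vectorSpan K hx hx₀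
      | zero => simp
      | add x y _ _ hx hy =>
        convert Submodule.add_mem _ hx hy using 1
        rw [map_add, add_smul]
        abel
      | smul a x _ hx =>
        convert Submodule.smul_mem _ a hx using 1
        rw [map_smul, smul_sub, smul_eq_mul, mul_smul]
    intro x hx
    simpa only [LinearMap.mem_ker.1 hx, zero_smul, sub_zero] using hproj x

variable [DecidableEq ι]

theorem span_range_update_eq_top [Finite ι] (b : Basis ι K V) {i : ι} {n : V}
    (hn : b.repr n i ≠ 0) : Submodule.span K (Set.range (Function.update b i n)) = ⊤ := by
  cases nonempty_fintype ι
  set W := Submodule.span K (Set.range (Function.update b i n))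
  have hj : ∀ j, j ≠ i → b j ∈ W := fun j hj =>
    Submodule.subset_span ⟨j, Function.update_of_ne hj _ _⟩
  have hi : b.repr n i • b i ∈ W := by
    have hsum := b.sum_repr n
    rw [← Finset.add_sum_erase _ _ (Finset.mem_univ i)] at hsum
    rw [eq_sub_of_add_eq hsum]
    exact W.sub_mem (Submodule.subset_span ⟨i, Function.update_self _ _ _⟩)
      (W.sum_mem fun k hk => W.smul_mem _ (hj k (Finset.ne_of_mem_erase hk)))
  rw [eq_top_iff, ← b.span_eq, Submodule.span_le]
  rintro _ ⟨j, rfl⟩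
  rcases eq_or_ne j i with rfl | hji
  · exact (W.smul_mem_iff hn).1 hi
  · exact hj j hji

end LinearAlgebra

section Exchange

variable {ι R V : Type*} [CommRing R] [AddCommGroup V] [Module R V] [DecidableEq ι]
  {b b' : Basis ι R V} {i : ι} {n : V}

theorem coord_self_of_coe_eq_update (hb' : ⇑b' = Function.update b i n) (hn : b.repr n i = -1) :
    b'.coord i = -b.coord i := by
  refine b'.ext fun k => ?_
  rw [Basis.coord_apply, Basis.repr_self, hb']
  rcases eq_or_ne k i with rfl | hk
  · simp [hn]
  · simp [hk]

theorem coord_of_coe_eq_update (hb' : ⇑b' = Function.update b i n) (hn : b.repr n i = -1)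
    {j : ι} (hj : j ≠ i) : b'.coord j = b.coord j + b.repr n j • b.coord i := by
  refine b'.ext fun k => ?_
  rw [Basis.coord_apply, Basis.repr_self, hb']
  rcases eq_or_ne k i with rfl | hk
  · simp [hn, hj]
  · simp [hk, Finsupp.single_apply]

end Exchange

theorem exists_int_mul_repr_eq_one {ι V : Type*} [AddCommGroup V] [Module ℝ V] [DecidableEq ι]
    {b : Basis ι ℝ V} {i : ι} {n : V} (h : b i ∈
    Submodule.span ℤ (Set.range (Function.update b i n))) : ∃ m : ℤ, m * b.repr n i = 1 := by
  have hmul : ∀ x ∈ Submodule.span ℤ (Set.range (Function.update b i n)),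
      ∃ m : ℤ, m * b.repr n i = b.repr x i := by
    intro x hx
    induction hx using Submodule.span_induction with
    | mem x hx =>
      obtain ⟨j, rfl⟩ := hx
      rcases eq_or_ne j i with rfl | hj
      · exact ⟨1, by simp⟩
      · exact ⟨0, by simp [hj]⟩
    | zero => exact ⟨0, by simp⟩
    | add x y _ _ hx hy =>
      obtain ⟨p, hp⟩ := hx
      obtain ⟨q, hq⟩ := hy
      exact ⟨p + q, by simp [← hp, ← hq, add_mul]⟩
    | smul a x _ hx =>
      obtain ⟨p, hp⟩ := hx
      refine ⟨a * p, ?_⟩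
      rw [← Int.cast_smul_eq_zsmul ℝ a x, map_smul]
      simp [← hp, mul_assoc]
  simpa using hmul (b i) h

section Polytopes

variable {d : ℕ} {P F : Set (Fin d → ℝ)} {l : (Fin d → ℝ) →ₗ[ℝ] ℝ}

/-- A convex polytope with the origin in its interior. Unlike a Fano polyhedron it need be neither
simplicial nor integral. -/
structure IsCentered (P : Set (Fin d → ℝ)) : Prop where
  polytope : ∃ s : Set (Fin d → ℝ), s.Finite ∧ P = convexHull ℝ s
  zero_mem_interior : (0 : Fin d → ℝ) ∈ interior P

theorem IsFanoPolyhedron.isCentered (hP : IsFanoPolyhedron P) : IsCentered P :=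
  ⟨hP.polytope, hP.zero_mem⟩

theorem vertices_eq_inter_of_isExposed (hF : IsExposed ℝ P F) : vertices F = F ∩ vertices P :=
  hF.isExtreme.extremePoints_eq

theorem isExposed_of_le_one (hl : ∀ x ∈ P, l x ≤ 1) : IsExposed ℝ P {x ∈ P | l x = 1} := by
  rintro ⟨x₀, hx₀, h₀⟩
  refine ⟨LinearMap.toContinuousLinearMap l, ?_⟩
  ext x
  simp only [Set.mem_ofPred_eq, LinearMap.coe_toContinuousLinearMap']
  refine and_congr_right fun hx => ⟨fun h y hy => h ▸ hl y hy, fun h => ?_⟩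
  exact le_antisymm (hl x hx) (h₀ ▸ h x₀ hx₀)

theorem exists_supporting_functional (hP : Convex ℝ P) (hne : (interior P).Nonempty)
    {x : Fin d → ℝ} (hx : x ∉ interior P) :
    ∃ f : (Fin d → ℝ) →L[ℝ] ℝ, (∀ y ∈ interior P, f y < f x) ∧ ∀ y ∈ P, f y ≤ f x := by
  obtain ⟨f, hf⟩ := geometric_hahn_banach_open_point hP.interior isOpen_interior hx
  have hcl : P ⊆ closure (interior P) :=
    hP.closure_interior_eq_closure_of_nonempty_interior hne ▸ subset_closure
  exact ⟨f, hf, fun y hy => closure_minimal (fun z hz => (hf z hz).le)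
    (isClosed_le f.continuous continuous_const) (hcl hy)⟩

/-- If `0` is not interior, a separating functional is nonpositive at all `v j`; then the positive
relation forces it to vanish at all of them. -/
theorem zero_mem_interior_convexHull {ι : Type*} [Fintype ι] [Nonempty ι] {v : ι → Fin d → ℝ}
    {c : ι → ℝ} (hc : ∀ j, 0 < c j) (hsum : ∑ j, c j • v j = 0)
    (hspan : Submodule.span ℝ (Set.range v) = ⊤) :
    (0 : Fin d → ℝ) ∈ interior (convexHull ℝ (Set.range v)) := by
  set P := convexHull ℝ (Set.range v)
  have hvP : ∀ j, v j ∈ P := fun j => subset_convexHull ℝ _ ⟨j, rfl⟩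
  have hzero : (0 : Fin d → ℝ) ∈ P := by
    rw [← smul_zero (∑ j, c j)⁻¹, ← hsum]
    exact (convex_convexHull ℝ _).centerMass_mem (fun j _ => (hc j).le)
      (Finset.sum_pos (fun j _ => hc j) Finset.univ_nonempty) fun j _ => hvP j
  have hne : (interior P).Nonempty := by
    rw [interior_convexHull_nonempty_iff_affineSpan_eq_top, ← affineSpan_convexHull]
    change affineSpan ℝ P = ⊤
    apply SetLike.coe_injective
    rw [← Set.insert_eq_of_mem hzero, affineSpan_insert_zero,
      top_le_iff.1 (hspan.ge.trans (Submodule.span_mono (subset_convexHull ℝ _)))]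
    rfl
  by_contra h0
  obtain ⟨f, hf, hle⟩ := exists_supporting_functional (convex_convexHull ℝ _) hne h0
  rw [map_zero] at hf hle
  have hvanish : ∀ j, f (v j) = 0 := by
    have h : ∑ j, c j * f (v j) = 0 := by simpa using congrArg f hsum
    rw [Finset.sum_eq_zero_iff_of_nonpos fun j _ =>
      mul_nonpos_of_nonneg_of_nonpos (hc j).le (hle _ (hvP j))] at h
    exact fun j => (mul_eq_zero.1 (h j (Finset.mem_univ j))).resolve_left (hc j).ne'
  obtain ⟨x, hx⟩ := hne
  have hker : Submodule.span ℝ (Set.range v) ≤ LinearMap.ker (f : (Fin d → ℝ) →ₗ[ℝ] ℝ) :=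
    Submodule.span_le.2 (Set.range_subset_iff.2 hvanish)
  exact (hf x hx).ne (hker (hspan ▸ Submodule.mem_top))

namespace IsCentered

variable (hP : IsCentered P)

include hP

theorem zero_mem : (0 : Fin d → ℝ) ∈ P := interior_subset hP.zero_mem_interior

theorem finite_vertices : (vertices P).Finite := by
  obtain ⟨s, hs, rfl⟩ := hP.polytope
  exact hs.subset extremePoints_convexHull_subset

theorem convex : Convex ℝ P := by
  obtain ⟨s, -, rfl⟩ := hP.polytope
  exact convex_convexHull ℝ s

theorem isCompact : IsCompact P := by
  obtain ⟨s, hs, rfl⟩ := hP.polytope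
  exact hs.isCompact_convexHull ℝ

theorem convexHull_vertices_of_isExposed (hF : IsExposed ℝ P F) :
    convexHull ℝ (vertices F) = F := by
  have hfin : (vertices F).Finite :=
    hP.finite_vertices.subset hF.isExtreme.extremePoints_subset_extremePoints
  rw [← (hfin.isClosed_convexHull ℝ).closure_eq]
  exact closure_convexHull_extremePoints (hF.isCompact hP.isCompact) (hF.convex hP.convex)

theorem convexHull_vertices : convexHull ℝ (vertices P) = P :=
  hP.convexHull_vertices_of_isExposed (IsExposed.refl P)

theorem le_of_mem {c : ℝ} (hl : ∀ v ∈ vertices P, l v ≤ c) {x : Fin d → ℝ} (hx : x ∈ P) :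
    l x ≤ c := by
  rw [← hP.convexHull_vertices] at hx
  exact convexHull_min (t := {x | l x ≤ c}) hl (convex_halfSpace_le l.isLinear c) hx

theorem exists_smul_mem (x : Fin d → ℝ) : ∃ t : ℝ, 0 < t ∧ t • x ∈ P := by
  have hP0 : P ∈ nhds ((0 : ℝ) • x) := by
    simpa only [zero_smul] using mem_interior_iff_mem_nhds.1 hP.zero_mem_interior
  have hcont : Filter.Tendsto (fun t : ℝ => t • x) (nhdsWithin 0 (Set.Ioi 0))
      (nhds ((0 : ℝ) • x)) := (Continuous.tendsto (by fun_prop) 0).mono_left nhdsWithin_le_nhds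
  obtain ⟨t, ht, hpos⟩ := ((hcont.eventually hP0).and self_mem_nhdsWithin).exists
  exact ⟨t, hpos, ht⟩

theorem exists_vertex_pos (hl : l ≠ 0) : ∃ v ∈ vertices P, 0 < l v := by
  by_contra! h
  have hnonpos : ∀ y, l y ≤ 0 := fun y => by
    obtain ⟨t, ht, hty⟩ := hP.exists_smul_mem y
    have := hP.le_of_mem h hty
    rw [map_smul, smul_eq_mul] at this
    exact nonpos_of_mul_nonpos_right this ht
  refine hl (LinearMap.ext fun x => le_antisymm (hnonpos x) ?_)
  simpa using hnonpos (-x)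

theorem finrank_vectorSpan : Module.finrank ℝ (vectorSpan ℝ P) = d := by
  have h := hP.convex.interior_nonempty_iff_affineSpan_eq_top.1 ⟨0, hP.zero_mem_interior⟩
  rw [← direction_affineSpan, h, AffineSubspace.direction_top, finrank_top, Module.finrank_fin_fun]

theorem exists_functional_of_mem_vertices [NeZero d] {x : Fin d → ℝ} (hx : x ∈ vertices P) :
    ∃ l : (Fin d → ℝ) →ₗ[ℝ] ℝ, (∀ y ∈ P, l y ≤ 1) ∧ l x = 1 := by
  obtain ⟨f, hlt, hle⟩ := exists_supporting_functional hP.convex ⟨0, hP.zero_mem_interior⟩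
    (Set.disjoint_right.1 (disjoint_interior_extremePoints P) hx)
  have hpos : 0 < f x := by simpa using hlt 0 hP.zero_mem_interior
  refine ⟨(f x)⁻¹ • (f : (Fin d → ℝ) →ₗ[ℝ] ℝ), fun y hy => ?_, ?_⟩
  · simpa [inv_mul_le_iff₀ hpos] using hle y hy
  · simp [hpos.ne']

theorem isProperFace_of_le_one (hl : ∀ x ∈ P, l x ≤ 1) : IsProperFace P {x ∈ P | l x = 1} := by
  refine ⟨isExposed_of_le_one hl, fun h => ?_⟩
  have := h ▸ hP.zero_mem
  simp at this

theorem exists_functional_of_isProperFace (hF : IsProperFace P F) (hne : F.Nonempty) :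
    ∃ l : (Fin d → ℝ) →ₗ[ℝ] ℝ, (∀ x ∈ P, l x ≤ 1) ∧ F = {x ∈ P | l x = 1} := by
  obtain ⟨l, hl⟩ := hF.1 hne
  obtain ⟨x₀, hx₀⟩ := hne
  obtain ⟨hx₀P, hmax⟩ := hl ▸ hx₀
  have hl0 : (l : (Fin d → ℝ) →ₗ[ℝ] ℝ) ≠ 0 := fun h0 => hF.2 <| by
    have h : ∀ x, l x = 0 := LinearMap.congr_fun h0
    simp [hl, h]
  have hpos : 0 < l x₀ := by
    obtain ⟨v, hv, hlv⟩ := hP.exists_vertex_pos hl0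
    exact hlv.trans_le (hmax v (extremePoints_subset hv))
  refine ⟨(l x₀)⁻¹ • (l : (Fin d → ℝ) →ₗ[ℝ] ℝ), fun x hx => ?_, ?_⟩
  · simpa [inv_mul_le_iff₀ hpos] using hmax x hx
  · rw [hl]
    ext x
    simp only [Set.mem_ofPred_eq, LinearMap.smul_apply, ContinuousLinearMap.coe_coe, smul_eq_mul,
      inv_mul_eq_one₀ hpos.ne']
    exact and_congr_right fun hx =>
      ⟨fun h => le_antisymm (h x₀ hx₀P) (hmax x hx), fun h y hy => h ▸ hmax y hy⟩

end IsCentered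

end Polytopes

section FaceSets

variable {d : ℕ} {ι : Type*}

/-- The hyperplane `l = 1` of some linear functional `l` supports the vectors `v j` exactly at the
indices `j ∈ S`. If the `v j` are the vertices of a polytope with `0` in its interior, this says
that `S` indexes the vertices of a proper face. -/
def IsFaceSet (v : ι → Fin d → ℝ) (S : Finset ι) : Prop :=
  ∃ l : (Fin d → ℝ) →ₗ[ℝ] ℝ, (∀ j, l (v j) ≤ 1) ∧ ∀ j, l (v j) = 1 ↔ j ∈ S

theorem linearMap_nonneg_of_mem_hull {W : Set (Fin d → ℝ)} {g : (Fin d → ℝ) →ₗ[ℝ] ℝ}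
    (hg : ∀ x ∈ W, 0 ≤ g x) {x : Fin d → ℝ} (hx : x ∈ PointedCone.hull ℝ W) : 0 ≤ g x := by
  refine Submodule.span_induction (p := fun x _ => 0 ≤ g x) hg (by simp) ?_ ?_ hx
  · intro x y _ _ hx hy
    rw [map_add]
    exact add_nonneg hx hy
  · intro c x _ hx
    rw [show g (c • x) = (c : ℝ) * g x from g.map_smul c.1 x]
    exact mul_nonneg c.2 hx

section Family

variable {v : ι → Fin d → ℝ} {S T : Finset ι}

theorem injective_of_isFaceSet_singleton (h : ∀ j, IsFaceSet v {j}) : Function.Injective v := by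
  intro i j hij
  obtain ⟨l, -, hl⟩ := h i
  exact (Finset.mem_singleton.1 ((hl j).1 (hij ▸ (hl i).2 (Finset.mem_singleton_self i)))).symm

theorem vertices_convexHull_range [Finite ι]
    (h0 : (0 : Fin d → ℝ) ∈ interior (convexHull ℝ (Set.range v))) (h : ∀ j, IsFaceSet v {j}) :
    vertices (convexHull ℝ (Set.range v)) = Set.range v := by
  set P := convexHull ℝ (Set.range v)
  have hP : IsCentered P := ⟨⟨_, Set.finite_range v, rfl⟩, h0⟩
  refine subset_antisymm extremePoints_convexHull_subset ?_
  rintro _ ⟨j, rfl⟩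
  obtain ⟨l, hle, hl⟩ := h j
  have hF := isExposed_of_le_one fun x (hx : x ∈ P) =>
    convexHull_min (t := {x | l x ≤ 1}) (Set.range_subset_iff.2 hle)
      (convex_halfSpace_le l.isLinear 1) hx
  obtain ⟨x, hx⟩ : (vertices {x ∈ P | l x = 1}).Nonempty := by
    rw [← convexHull_nonempty_iff (𝕜 := ℝ), hP.convexHull_vertices_of_isExposed hF]
    exact ⟨v j, subset_convexHull ℝ _ ⟨j, rfl⟩, (hl j).2 (Finset.mem_singleton_self j)⟩
  rw [vertices_eq_inter_of_isExposed hF] at hx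
  obtain ⟨k, rfl⟩ := extremePoints_convexHull_subset hx.2
  rw [← Finset.mem_singleton.1 ((hl k).1 hx.1.2)]
  exact hx.2

theorem exists_linearMap_apply_eq {K V : Type*} [Field K] [AddCommGroup V] [Module K V]
    {w : ι → V} (hw : LinearIndependent K w) (c : ι → K) : ∃ g : V →ₗ[K] K, ∀ i, g (w i) = c i := by
  obtain ⟨g, hg⟩ := LinearMap.exists_extend ((Basis.span hw).constr K c)
  refine ⟨g, fun i => ?_⟩
  have h := LinearMap.congr_fun hg (Basis.span hw i)
  rwa [Basis.constr_basis, LinearMap.comp_apply, Submodule.subtype_apply, Basis.span_apply] at h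

/-- Tilt the supporting hyperplane of the larger set slightly, away from the indices outside the
smaller one. -/
theorem IsFaceSet.mono [Finite ι] (hT : IsFaceSet v T)
    (hli : LinearIndependent ℝ fun j : T => v j) (hST : S ⊆ T) : IsFaceSet v S := by
  classical
  obtain ⟨l, hle, hl⟩ := hT
  obtain ⟨g, hg⟩ := exists_linearMap_apply_eq hli
    fun j => if (j : ι) ∈ S then (0 : ℝ) else 1
  obtain ⟨ε, hε, hpos⟩ : ∃ ε : ℝ, (∀ j, j ∉ T → l (v j) - ε * g (v j) < 1) ∧ 0 < ε := by
    suffices h : ∀ j, ∀ᶠ ε in nhdsWithin (0 : ℝ) (Set.Ioi 0), j ∉ T → l (v j) - ε * g (v j) < 1 from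
      ((Filter.eventually_all.2 h).and self_mem_nhdsWithin).exists
    intro j
    by_cases hj : j ∈ T
    · exact .of_forall fun _ h => absurd hj h
    have hcont : Filter.Tendsto (fun ε : ℝ => l (v j) - ε * g (v j)) (nhds 0) (nhds (l (v j))) := by
      simpa using (show Continuous fun ε : ℝ => l (v j) - ε * g (v j) by fun_prop).tendsto 0
    filter_upwards [(hcont.mono_left nhdsWithin_le_nhds).eventually_lt_const
      ((hle j).lt_of_ne (mt (hl j).1 hj))] with ε hε _ using hε
  have hval : ∀ j, (l - ε • g) (v j) ≤ 1 ∧ ((l - ε • g) (v j) = 1 ↔ j ∈ S) := by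
    intro j
    simp only [LinearMap.sub_apply, LinearMap.smul_apply, smul_eq_mul]
    by_cases hjT : j ∈ T
    · have hgj := hg ⟨j, hjT⟩
      by_cases hjS : j ∈ S <;> simp [(hl j).2 hjT, hgj, hjS, hpos.le, hpos.ne']
    · exact ⟨(hε j hjT).le, iff_of_false (hε j hjT).ne (mt (@hST j) hjT)⟩
  exact ⟨_, fun j => (hval j).1, fun j => (hval j).2⟩

theorem IsFaceSet.toFinset_subset_of_sum_mem_hull [DecidableEq ι] {m : Multiset ι}
    (hm : IsFaceSet v m.toFinset) (hT : IsFaceSet v T)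
    (h : (m.map v).sum ∈ PointedCone.hull ℝ (v '' T)) : m.toFinset ⊆ T := by
  obtain ⟨l, hle, hl⟩ := hT
  obtain ⟨p, hple, hp⟩ := hm
  have hnonneg : 0 ≤ (l - p) (m.map v).sum := by
    refine linearMap_nonneg_of_mem_hull ?_ h
    rintro _ ⟨k, hk, rfl⟩
    rw [LinearMap.sub_apply, (hl k).2 hk, sub_nonneg]
    exact hple k
  rw [LinearMap.sub_apply, map_multiset_sum, map_multiset_sum, Multiset.map_map,
    Multiset.map_map, sub_nonneg] at hnonneg
  by_contra hsub
  obtain ⟨j, hj, hjT⟩ := Finset.not_subset.1 hsub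
  refine hnonneg.not_gt (Multiset.sum_lt_sum (fun k hk => ?_) ⟨j, Multiset.mem_toFinset.1 hj, ?_⟩)
  · exact (hle k).trans_eq ((hp k).2 (Multiset.mem_toFinset.2 hk)).symm
  · exact ((hle j).lt_of_ne (mt (hl j).1 hjT)).trans_eq ((hp j).2 hj).symm

theorem multiset_sum_map_mem_hull [DecidableEq ι] (m : Multiset ι) :
    (m.map v).sum ∈ PointedCone.hull ℝ (v '' m.toFinset) := by
  refine multiset_sum_mem _ fun x hx => ?_
  obtain ⟨j, hj, rfl⟩ := Multiset.mem_map.1 hx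
  exact Submodule.subset_span ⟨j, by simpa using hj, rfl⟩

theorem IsFaceSet.eq_of_sum_map_eq [DecidableEq ι] {m m' : Multiset ι}
    (hm : IsFaceSet v m.toFinset) (hm' : IsFaceSet v m'.toFinset)
    (hli : LinearIndependent ℝ fun j : m.toFinset => v j)
    (h : (m.map v).sum = (m'.map v).sum) : m = m' := by
  have hsupp : m.toFinset = m'.toFinset :=
    (hm.toFinset_subset_of_sum_mem_hull hm' (h ▸ multiset_sum_map_mem_hull m')).antisymm
      (hm'.toFinset_subset_of_sum_mem_hull hm (h ▸ multiset_sum_map_mem_hull m))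
  have hsum : ∀ n : Multiset ι, n.toFinset = m.toFinset →
      (n.map v).sum = ∑ j : m.toFinset, (n.count (j : ι) : ℝ) • v j := by
    intro n hn
    rw [Finset.sum_multiset_map_count, hn, ← Finset.sum_coe_sort]
    simp only [Nat.cast_smul_eq_nsmul]
  rw [hsum m rfl, hsum m' hsupp.symm] at h
  have hcount := Fintype.linearIndependent_iffₛ.1 hli _ _ h
  ext j
  by_cases hj : j ∈ m.toFinset
  · exact_mod_cast hcount ⟨j, hj⟩
  · rw [Multiset.count_eq_zero.2 (mt Multiset.mem_toFinset.2 hj),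
      Multiset.count_eq_zero.2 (mt Multiset.mem_toFinset.2 (hsupp ▸ hj))]

end Family

end FaceSets

theorem linearIndependent_of_affineIndependent {ι K V : Type*} [Field K] [AddCommGroup V]
    [Module K V] {w : ι → V} (hw : AffineIndependent K w) {l : V →ₗ[K] K}
    (hl : ∀ i, l (w i) = 1) : LinearIndependent K w := by
  rw [linearIndependent_iff']
  intro s g hg
  refine affineIndependent_iff.1 hw s g ?_ hg
  simpa [hl] using congrArg l hg

section Fan

variable {d : ℕ} {P F : Set (Fin d → ℝ)}

theorem subset_faceCone : vertices F ⊆ faceCone F :=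
  Submodule.subset_span

theorem coneDim_faceCone : coneDim (faceCone F) = finrank ℝ (Submodule.span ℝ (vertices F)) := by
  suffices h : Submodule.span ℝ (faceCone F : Set (Fin d → ℝ)) = Submodule.span ℝ (vertices F) by
    rw [coneDim, h]
  refine le_antisymm (Submodule.span_le.2 fun x hx => ?_) (Submodule.span_mono subset_faceCone)
  refine Submodule.span_induction (p := fun x _ => x ∈ Submodule.span ℝ (vertices F))
    (fun x hx => Submodule.subset_span hx) (Submodule.zero_mem _)
    (fun x y _ _ => Submodule.add_mem _) ?_ hx
  intro c x _ hx
  exact Submodule.smul_mem _ (c : ℝ) hx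

/-- A convex polytope with the origin in its interior all of whose proper faces are simplices. -/
structure IsSimplicial (P : Set (Fin d → ℝ)) : Prop extends IsCentered P where
  affineIndependent : ∀ F, IsProperFace P F →
    AffineIndependent ℝ (Subtype.val : vertices F → (Fin d → ℝ))

theorem IsFanoPolyhedron.isSimplicial (hP : IsFanoPolyhedron P) : IsSimplicial P :=
  ⟨hP.isCentered, hP.simplicial⟩

theorem IsSimplicial.finrank_vectorSpan_add_one (hP : IsSimplicial P) {F : Set (Fin d → ℝ)}
    (hF : IsProperFace P F) (hne : F.Nonempty) :
    Module.finrank ℝ (vectorSpan ℝ F) + 1 = (vertices F).ncard := by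
  have : Fintype (vertices F) := (hP.finite_vertices.subset
    hF.1.isExtreme.extremePoints_subset_extremePoints).fintype
  have hF' := hP.convexHull_vertices_of_isExposed hF.1
  have : Nonempty (vertices F) := Set.Nonempty.to_subtype (convexHull_nonempty_iff.1 (hF' ▸ hne))
  rw [← Nat.card_coe_set_eq, Nat.card_eq_fintype_card,
    ← (hP.affineIndependent F hF).finrank_vectorSpan_add_one, Subtype.range_coe, ← hF',
    ← direction_affineSpan, affineSpan_convexHull, direction_affineSpan, hF']

section Numbered

variable {ι : Type*} {v : ι ↪ (Fin d → ℝ)} {S T : Finset ι}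

theorem IsCentered.isFaceSet_iff (hP : IsCentered P) (hv : Set.range v = vertices P) :
    IsFaceSet v S ↔ ∃ F, IsProperFace P F ∧ vertices F = v '' S := by
  constructor
  · rintro ⟨l, hle, hl⟩
    have hle' : ∀ x ∈ vertices P, l x ≤ 1 := by
      rw [← hv]
      exact Set.forall_mem_range.2 hle
    have hF := hP.isProperFace_of_le_one fun x => hP.le_of_mem hle'
    refine ⟨_, hF, ?_⟩
    rw [vertices_eq_inter_of_isExposed hF.1]
    ext x
    constructor
    · rintro ⟨⟨-, hx⟩, hxP⟩
      obtain ⟨j, rfl⟩ := hv.superset hxP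
      exact ⟨j, (hl j).1 hx, rfl⟩
    · rintro ⟨j, hj, rfl⟩
      have hjP := hv.subset ⟨j, rfl⟩
      exact ⟨⟨extremePoints_subset hjP, (hl j).2 hj⟩, hjP⟩
  · rintro ⟨F, hF, hFS⟩
    rcases F.eq_empty_or_nonempty with rfl | hne
    · have hS : S = ∅ := by
        simpa [vertices] using hFS.symm
      exact ⟨0, by simp, by simp [hS]⟩
    obtain ⟨l, hle, rfl⟩ := hP.exists_functional_of_isProperFace hF hne
    have hmem : ∀ j, v j ∈ vertices P := fun j => hv.subset ⟨j, rfl⟩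
    refine ⟨l, fun j => hle _ (extremePoints_subset (hmem j)), fun j => ?_⟩
    have h : v j ∈ v '' S ↔ j ∈ S := v.injective.mem_set_image
    rw [← h, ← hFS, vertices_eq_inter_of_isExposed hF.1]
    exact ⟨fun hj => ⟨⟨extremePoints_subset (hmem j), hj⟩, hmem j⟩, fun hj => hj.1.2⟩

theorem IsCentered.exists_isFaceSet_of_isProperFace [Finite ι] (hP : IsCentered P)
    (hv : Set.range v = vertices P) (hF : IsProperFace P F) :
    ∃ S : Finset ι, IsFaceSet v S ∧ vertices F = v '' S := by
  obtain ⟨S, hS⟩ := (Set.toFinite (v ⁻¹' vertices F)).exists_finset_coe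
  have hFS : vertices F = v '' S := by
    rw [hS, Set.image_preimage_eq_of_subset]
    exact hv ▸ hF.1.isExtreme.extremePoints_subset_extremePoints
  exact ⟨S, (hP.isFaceSet_iff hv).2 ⟨F, hF, hFS⟩, hFS⟩

namespace IsSimplicial

variable (hP : IsSimplicial P) (hv : Set.range v = vertices P)

include hP hv

theorem linearIndependent (hS : IsFaceSet v S) : LinearIndependent ℝ fun j : S => v j := by
  obtain ⟨F, hF, hFS⟩ := (hP.isFaceSet_iff hv).1 hS
  obtain ⟨l, -, hl⟩ := hS
  refine linearIndependent_of_affineIndependent (l := l) ?_ fun j => (hl j).2 j.2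
  exact (hP.affineIndependent F hF).comp_embedding
    ⟨fun j : S => ⟨v j, hFS ▸ ⟨j, j.2, rfl⟩⟩, fun i j h =>
      Subtype.ext (v.injective (congrArg Subtype.val h))⟩

variable [Finite ι]

theorem isFaceSet_of_subset (hT : IsFaceSet v T) (hST : S ⊆ T) : IsFaceSet v S :=
  hT.mono (hP.linearIndependent hv hT) hST

theorem isFaceSet_singleton [NeZero d] (j : ι) : IsFaceSet v {j} := by
  have hv' : ∀ i, v i ∈ vertices P := fun i => hv.subset ⟨i, rfl⟩
  obtain ⟨l, hle, hl⟩ := hP.exists_functional_of_mem_vertices (hv' j)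
  obtain ⟨S, hS⟩ := (Set.toFinite {i | l (v i) = 1}).exists_finset_coe
  have hface : IsFaceSet v S := ⟨l, fun i => hle _ (extremePoints_subset (hv' i)), fun i => by
    rw [← Finset.mem_coe, hS, Set.mem_ofPred_eq]⟩
  refine hP.isFaceSet_of_subset hv hface (Finset.singleton_subset_iff.2 ?_)
  rwa [← Finset.mem_coe, hS, Set.mem_ofPred_eq]

theorem exists_mem_fan_iff [NeZero d] :
    (∃ σ ∈ fan P, v '' S ⊆ (σ : Set (Fin d → ℝ))) ↔ IsFaceSet v S := by
  classical
  constructor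
  · rintro ⟨_, ⟨F, hF, rfl⟩, hS⟩
    obtain ⟨T, hT, hFT⟩ := hP.exists_isFaceSet_of_isProperFace hv hF
    refine hP.isFaceSet_of_subset hv hT fun j hj => ?_
    have hj' : IsFaceSet v (Multiset.toFinset {j}) := by
      simpa using hP.isFaceSet_singleton hv j
    rw [faceCone, hFT] at hS
    have hmem : (Multiset.map v {j}).sum ∈ PointedCone.hull ℝ (v '' T) := by
      simpa using hS ⟨j, hj, rfl⟩
    exact hj'.toFinset_subset_of_sum_mem_hull hT hmem (by simp)
  · intro hS
    obtain ⟨F, hF, hFS⟩ := (hP.isFaceSet_iff hv).1 hS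
    exact ⟨_, ⟨F, hF, rfl⟩, hFS ▸ subset_faceCone⟩

theorem isPrimitiveCollection_map_iff [NeZero d] :
    IsPrimitiveCollection P (S.map v) ↔ Minimal (fun T => ¬ IsFaceSet v T) S := by
  have hfan : ∀ T : Finset ι, (∃ σ ∈ fan P, ((T.map v : Finset _) : Set (Fin d → ℝ)) ⊆ σ) ↔
      IsFaceSet v T := fun T => by
    rw [Finset.coe_map]
    exact hP.exists_mem_fan_iff hv
  rw [IsPrimitiveCollection, minimal_iff_forall_lt, hfan]
  refine ⟨fun ⟨_, h, h'⟩ => ⟨h, fun T hT => not_not.2 ((hfan T).1 (h' _ (by simpa using hT)))⟩,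
    fun ⟨h, h'⟩ => ⟨?_, h, fun B hB => ?_⟩⟩
  · rw [← hv, Finset.coe_map]
    exact Set.image_subset_range _ _
  · obtain ⟨T, -, rfl⟩ := Finset.subset_map_iff.1 hB.subset
    exact (hfan T).2 (not_not.1 (h' (Finset.map_ssubset_map.1 hB)))

theorem isPrimitiveRelation_map_iff [NeZero d] [DecidableEq ι] {R : Multiset ι} :
    IsPrimitiveRelation P (S.map v) (R.map v) ↔ Minimal (fun T => ¬ IsFaceSet v T) S ∧
      IsFaceSet v R.toFinset ∧ ∑ j ∈ S, v j = (R.map v).sum := by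
  have hR : {x | x ∈ R.map v} = v '' R.toFinset := by
    ext x
    simp
  rw [IsPrimitiveRelation, hP.isPrimitiveCollection_map_iff hv, Finset.sum_map, hR]
  refine and_congr_right fun _ => ⟨?_, ?_⟩
  · rintro ⟨F, hF, -, -, hFR, hsum⟩
    exact ⟨(hP.isFaceSet_iff hv).2 ⟨F, hF, hFR.symm⟩, hsum⟩
  · rintro ⟨hface, hsum⟩
    obtain ⟨F, hF, hFR⟩ := (hP.isFaceSet_iff hv).1 hface
    rw [hsum]
    refine ⟨F, hF, ?_, ?_, hFR.symm, rfl⟩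
    · rw [faceCone, hFR]
      exact multiset_sum_map_mem_hull R
    · rintro _ ⟨F', hF', rfl⟩ hmem
      obtain ⟨T, hT, hFT⟩ := hP.exists_isFaceSet_of_isProperFace hv hF'
      rw [faceCone, hFT] at hmem
      rw [coneDim_faceCone, coneDim_faceCone, hFR, hFT]
      exact Submodule.finrank_mono (Submodule.span_mono (Set.image_mono
        (hface.toFinset_subset_of_sum_mem_hull hT hmem)))

theorem eq_of_isPrimitiveRelation_map [NeZero d] {R R' : Multiset ι}
    (h : IsPrimitiveRelation P (S.map v) (R.map v))
    (h' : IsPrimitiveRelation P (S.map v) (R'.map v)) : R = R' := by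
  classical
  obtain ⟨-, hR, hsum⟩ := (hP.isPrimitiveRelation_map_iff hv).1 h
  obtain ⟨-, hR', hsum'⟩ := (hP.isPrimitiveRelation_map_iff hv).1 h'
  exact hR.eq_of_sum_map_eq hR' (hP.linearIndependent hv hR) (hsum.symm.trans hsum')

theorem isFaceSet_iff_forall_minimal :
    IsFaceSet v S ↔ ∀ T, Minimal (fun T => ¬ IsFaceSet v T) T → ¬ T ⊆ S := by
  refine ⟨fun hS T hT hTS => hT.1 (hP.isFaceSet_of_subset hv hS hTS), fun h => ?_⟩
  by_contra hS
  obtain ⟨T, hTS, hT⟩ := exists_minimal_le_of_wellFoundedLT (fun T => ¬ IsFaceSet v T) S hS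
  exact h T hT hTS

omit [Finite ι] in
theorem isSimplexFace_image_iff [Fintype ι] (hcard : Fintype.card ι ≠ d + 1) :
    IsSimplexFace P (v '' T) ↔ T.Nonempty ∧ IsFaceSet v T := by
  have hncard : ∀ T : Finset ι, (v '' T).ncard = T.card := fun T => by
    rw [Set.ncard_image_of_injective _ v.injective, Set.ncard_coe_finset]
  constructor
  · rintro ⟨F, k, ⟨hF, -, hk⟩, hFT, hkT⟩
    rw [hncard] at hkT
    refine ⟨Finset.card_pos.1 (by omega), (hP.isFaceSet_iff hv).2 ⟨F, ⟨hF, ?_⟩, hFT⟩⟩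
    rintro rfl
    have hT : T = Finset.univ := Finset.coe_injective (v.injective.image_injective (by
      rw [← hFT, Finset.coe_univ, Set.image_univ, hv]))
    rw [hP.finrank_vectorSpan] at hk
    rw [hT, Finset.card_univ] at hkT
    omega
  · rintro ⟨hne, hT⟩
    obtain ⟨F, hF, hFT⟩ := (hP.isFaceSet_iff hv).1 hT
    obtain ⟨j, hj⟩ := hne
    have hF' : F.Nonempty := ⟨_, extremePoints_subset (hFT ▸ ⟨j, hj, rfl⟩ : v j ∈ vertices F)⟩
    exact ⟨F, _, ⟨hF.1, hF', rfl⟩, hFT, hFT ▸ hP.finrank_vectorSpan_add_one hF hF'⟩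

end IsSimplicial

end Numbered

end Fan

section Facets

variable {d : ℕ} {P : Set (Fin d → ℝ)} {l : (Fin d → ℝ) →ₗ[ℝ] ℝ}

theorem finrank_stdLattice : finrank ℤ (stdLattice d) = d := by
  have hli : LinearIndependent ℤ (Pi.basisFun ℝ (Fin d)) :=
    (Pi.basisFun ℝ (Fin d)).linearIndependent.restrict_scalars (by
      intro a b h
      simpa using h)
  exact (finrank_span_eq_card hli).trans (Fintype.card_fin d)

theorem mem_stdLattice_iff {x : Fin d → ℝ} : x ∈ stdLattice d ↔ ∀ i, ∃ n : ℤ, x i = n := by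
  rw [stdLattice, Basis.mem_span_iff_repr_mem]
  simp [eq_comm]

theorem IsLatticeBasis.ncard_eq {W : Set (Fin d → ℝ)} (h : IsLatticeBasis W) (hW : W.Finite) :
    W.ncard = d := by
  have := hW.fintype
  rw [Set.ncard_eq_toFinset_card', ← finrank_span_set_eq_card h.1, h.2, finrank_stdLattice]

theorem linearIndependent_of_span_eq_top {c : Fin d → Fin d → ℝ}
    (h : Submodule.span ℝ (Set.range c) = ⊤) : LinearIndependent ℝ c :=
  linearIndependent_of_top_le_span_of_card_eq_finrank h.ge (by simp)

theorem span_eq_top_of_stdLattice_le_span {W : Set (Fin d → ℝ)}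
    (h : stdLattice d ≤ Submodule.span ℤ W) : Submodule.span ℝ W = ⊤ := by
  rw [← top_le_iff, ← (Pi.basisFun ℝ (Fin d)).span_eq, ← Submodule.span_span_of_tower ℤ ℝ W]
  exact Submodule.span_mono (Submodule.subset_span.trans h)

theorem linearIndependent_of_stdLattice_le_span {c : Fin d → Fin d → ℝ}
    (h : stdLattice d ≤ Submodule.span ℤ (Set.range c)) : LinearIndependent ℝ c :=
  linearIndependent_of_span_eq_top (span_eq_top_of_stdLattice_le_span h)

/-- The vertices of `P` on the hyperplane `l = 1`; if `l ≤ 1` on `P`, these are the vertices of a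
face. -/
def tight (P : Set (Fin d → ℝ)) (l : (Fin d → ℝ) →ₗ[ℝ] ℝ) : Set (Fin d → ℝ) :=
  {v ∈ vertices P | l v = 1}

/-- The hyperplane `l = 1` supports `P` along a facet: the vertices on it span the whole space. -/
structure IsFacetFunctional (P : Set (Fin d → ℝ)) (l : (Fin d → ℝ) →ₗ[ℝ] ℝ) : Prop where
  le_one : ∀ v ∈ vertices P, l v ≤ 1
  span_tight : Submodule.span ℝ (tight P l) = ⊤

/-- The linear functional with value `1` on all vectors of a basis. -/
noncomputable def facetForm (b : Basis (Fin d) ℝ (Fin d → ℝ)) : (Fin d → ℝ) →ₗ[ℝ] ℝ :=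
  ∑ i, b.coord i

/-- The vectors of `b` are the vertices of a facet of `P` and generate the lattice. -/
structure IsFacetBasis (P : Set (Fin d → ℝ)) (b : Basis (Fin d) ℝ (Fin d → ℝ)) : Prop where
  le_one : ∀ v ∈ vertices P, facetForm b v ≤ 1
  tight_eq : tight P (facetForm b) = Set.range b
  span_eq : Submodule.span ℤ (Set.range b) = stdLattice d

/-- Exchanging `b i` for the vertex `n` turns the facet of `P` with basis `b` into the adjacent
facet across the ridge that omits `b i`. -/
structure IsFacetNeighbor (P : Set (Fin d → ℝ)) (b : Basis (Fin d) ℝ (Fin d → ℝ)) (i : Fin d)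
    (n : Fin d → ℝ) : Prop where
  mem_vertices : n ∈ vertices P
  notMem_range : n ∉ Set.range b
  repr_self : b.repr n i = -1
  exists_isFacetBasis : ∃ b' : Basis (Fin d) ℝ (Fin d → ℝ),
    ⇑b' = Function.update b i n ∧ IsFacetBasis P b'

section FacetForm

variable (b : Basis (Fin d) ℝ (Fin d → ℝ))

theorem facetForm_apply (x : Fin d → ℝ) : facetForm b x = ∑ i, b.repr x i := by
  simp [facetForm]

theorem facetForm_self (i : Fin d) : facetForm b (b i) = 1 := by
  simp [facetForm_apply, Finsupp.single_apply]

variable {b}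

theorem facetForm_eq (h : ∀ i, l (b i) = 1) : facetForm b = l :=
  b.ext fun i => by rw [facetForm_self, h]

theorem facetForm_of_coe_eq_update {b' : Basis (Fin d) ℝ (Fin d → ℝ)} {i : Fin d}
    {n : Fin d → ℝ} (hb' : ⇑b' = Function.update b i n) (hn : b.repr n i = -1) :
    facetForm b' = facetForm b - (1 - facetForm b n) • b.coord i := by
  refine facetForm_eq fun j => ?_
  rw [hb']
  rcases eq_or_ne j i with rfl | hj
  · simp [hn]
  · simp [facetForm_self, hj]

end FacetForm

namespace IsCentered

variable (hP : IsCentered P)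

include hP

theorem finite_tight : (tight P l).Finite :=
  hP.finite_vertices.subset fun _ h => h.1

/-- Rotate the hyperplane `l = 1` in the direction `w` until it meets a further vertex. -/
theorem exists_tight {w : (Fin d → ℝ) →ₗ[ℝ] ℝ} (hl : ∀ v ∈ vertices P, l v ≤ 1) (hw : w ≠ 0) :
    ∃ t : ℝ, (∀ v ∈ vertices P, (l + t • w) v ≤ 1) ∧ ∃ v ∈ tight P (l + t • w), 0 < w v := by
  obtain ⟨v₀, hv₀, hv₀'⟩ := hP.exists_vertex_pos hw
  obtain ⟨v, ⟨hv, hwv⟩, hmin⟩ := Set.exists_min_image {v ∈ vertices P | 0 < w v}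
    (fun v => (1 - l v) / w v) (hP.finite_vertices.subset fun _ h => h.1) ⟨v₀, hv₀, hv₀'⟩
  have ht : 0 ≤ (1 - l v) / w v := div_nonneg (sub_nonneg.2 (hl v hv)) hwv.le
  refine ⟨(1 - l v) / w v, fun u hu => ?_, v, ⟨hv, ?_⟩, hwv⟩
  · simp only [LinearMap.add_apply, LinearMap.smul_apply, smul_eq_mul]
    rcases lt_or_ge 0 (w u) with h | h
    · have := (le_div_iff₀ h).1 (hmin u ⟨hu, h⟩)
      linarith
    · linarith [hl u hu, mul_nonpos_of_nonneg_of_nonpos ht h]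
  · simp only [LinearMap.add_apply, LinearMap.smul_apply, smul_eq_mul]
    rw [div_mul_cancel₀ _ hwv.ne', add_sub_cancel]

/-- A functional `l ≤ 1` whose tight vertices span a maximal subspace is a facet functional:
otherwise it can be rotated while keeping its tight vertices. -/
theorem exists_isFacetFunctional : ∃ l, IsFacetFunctional P l := by
  obtain ⟨_, ⟨l, hl, rfl⟩, hmax⟩ := (wellFounded_gt (α := Submodule ℝ (Fin d → ℝ))).has_min
    {W | ∃ l : (Fin d → ℝ) →ₗ[ℝ] ℝ, (∀ v ∈ vertices P, l v ≤ 1) ∧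
      Submodule.span ℝ (tight P l) = W} ⟨_, 0, by simp, rfl⟩
  refine ⟨l, hl, ?_⟩
  by_contra hne
  obtain ⟨w, hw, hker⟩ := Submodule.exists_le_ker_of_lt_top _ (lt_top_iff_ne_top.2 hne)
  have hzero : ∀ x ∈ Submodule.span ℝ (tight P l), w x = 0 := fun x hx => hker hx
  obtain ⟨t, ht, v, hv, hwv⟩ := hP.exists_tight hl hw
  have hsub : tight P l ⊆ tight P (l + t • w) := fun x hx =>
    ⟨hx.1, by simp [hzero x (Submodule.subset_span hx), hx.2]⟩
  refine hmax _ ⟨_, ht, rfl⟩ (lt_of_le_of_ne (Submodule.span_mono hsub) fun h => ?_)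
  exact hwv.ne' (hzero v (h ▸ Submodule.subset_span hv))

theorem finite_isFacetFunctional : {l | IsFacetFunctional P l}.Finite := by
  refine Set.Finite.of_injOn (f := tight P) (t := 𝒫 (vertices P)) (fun l _ v hv => hv.1) ?_
    hP.finite_vertices.finite_subsets
  intro l hl l' _ h
  exact LinearMap.ext_on hl.span_tight fun v hv => hv.2.trans (h.subset hv).2.symm

end IsCentered

namespace IsFacetBasis

variable {b : Basis (Fin d) ℝ (Fin d → ℝ)} (hb : IsFacetBasis P b)

include hb

theorem mem_vertices (i : Fin d) : b i ∈ vertices P :=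
  (hb.tight_eq.superset (Set.mem_range_self i)).1

theorem facetForm_lt_one {v : Fin d → ℝ} (hv : v ∈ vertices P) (hvb : v ∉ Set.range b) :
    facetForm b v < 1 :=
  lt_of_le_of_ne (hb.le_one v hv) fun h => hvb (hb.tight_eq.subset ⟨hv, h⟩)

theorem exists_int {v : Fin d → ℝ} (hv : v ∈ stdLattice d) (i : Fin d) :
    ∃ n : ℤ, b.repr v i = n := by
  rw [← hb.span_eq, Basis.mem_span_iff_repr_mem] at hv
  obtain ⟨n, hn⟩ := hv i
  exact ⟨n, hn.symm⟩

theorem isFacetFunctional : IsFacetFunctional P (facetForm b) :=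
  ⟨hb.le_one, hb.tight_eq ▸ b.span_eq⟩

end IsFacetBasis

theorem IsFacetNeighbor.mul_neg_repr_lt {b : Basis (Fin d) ℝ (Fin d → ℝ)} {i : Fin d}
    {n v : Fin d → ℝ} (hn : IsFacetNeighbor P b i n) (hv : v ∈ vertices P)
    (hvb : v ∉ Set.range b) (hvn : v ≠ n) :
    (1 - facetForm b n) * -b.repr v i < 1 - facetForm b v := by
  obtain ⟨b', hb', hfacet⟩ := hn.exists_isFacetBasis
  have hvb' : v ∉ Set.range b' := by
    rw [hb']
    rintro ⟨j, rfl⟩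
    rcases eq_or_ne j i with rfl | hj
    · exact hvn (Function.update_self _ _ _)
    · exact hvb ⟨j, (Function.update_of_ne hj _ _).symm⟩
  have hlt := hfacet.facetForm_lt_one hv hvb'
  rw [facetForm_of_coe_eq_update hb' hn.repr_self] at hlt
  simp only [LinearMap.sub_apply, LinearMap.smul_apply, Basis.coord_apply, smul_eq_mul] at hlt
  linarith

namespace IsFanoPolyhedron

variable (hP : IsFanoPolyhedron P)

include hP

theorem isLatticeBasis_tight (hl : IsFacetFunctional P l) : IsLatticeBasis (tight P l) := by
  rcases (tight P l).eq_empty_or_nonempty with hempty | ⟨x₀, hx₀⟩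
  · have := (Submodule.subsingleton_iff ℝ (M := Fin d → ℝ)).1 <| subsingleton_of_bot_eq_top <| by
      rw [← hl.span_tight, hempty, Submodule.span_empty]
    rw [hempty]
    exact ⟨linearIndependent_empty_type, Subsingleton.elim _ _⟩
  have hl0 : l ≠ 0 := by
    rintro rfl
    simpa using hx₀.2
  have hexp := isExposed_of_le_one fun x => hP.isCentered.le_of_mem hl.le_one
  have hvert : vertices {x ∈ P | l x = 1} = tight P l := by
    rw [vertices_eq_inter_of_isExposed hexp]
    ext x
    exact ⟨fun h => ⟨h.2, h.1.2⟩, fun h => ⟨⟨extremePoints_subset h.1, h.2⟩, h.1⟩⟩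
  have hsub : tight P l ⊆ {x ∈ P | l x = 1} := hvert ▸ extremePoints_subset
  rw [← hvert]
  refine hP.unimodular _ (finrank ℝ (LinearMap.ker l)) ?_ ⟨hexp, ⟨x₀, hsub hx₀⟩, ?_⟩
  · rw [Dual.finrank_ker_add_one_of_ne_zero hl0, finrank_fin_fun]
  · rw [vectorSpan_eq_ker_of_span_eq_top ⟨x₀, hsub hx₀⟩ (fun x hx => hx.2)]
    exact top_le_iff.1 (hl.span_tight.ge.trans (Submodule.span_mono hsub))

theorem exists_isFacetBasis_of_mem_tight (hle : ∀ v ∈ vertices P, l v ≤ 1) {c : Fin d → Fin d → ℝ}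
    (hc : ∀ i, c i ∈ tight P l) (hspan : Submodule.span ℝ (Set.range c) = ⊤) :
    ∃ b : Basis (Fin d) ℝ (Fin d → ℝ), ⇑b = c ∧ facetForm b = l ∧ IsFacetBasis P b := by
  have hsub : Set.range c ⊆ tight P l := Set.range_subset_iff.2 hc
  have hl : IsFacetFunctional P l := ⟨hle, top_le_iff.1 (hspan.ge.trans (Submodule.span_mono hsub))⟩
  have hfin := hP.isCentered.finite_tight (l := l)
  have htight := hP.isLatticeBasis_tight hl
  have hli := linearIndependent_of_span_eq_top hspan
  have heq : Set.range c = tight P l := by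
    refine Set.eq_of_subset_of_ncard_le hsub (le_of_eq ?_) hfin
    rw [htight.ncard_eq hfin, Set.ncard_range_of_injective hli.injective, Nat.card_fin]
  have hb : ⇑(Basis.mk hli hspan.ge) = c := Basis.coe_mk _ _
  have hf : facetForm (Basis.mk hli hspan.ge) = l := facetForm_eq fun i => by
    rw [hb]
    exact (hc i).2
  refine ⟨_, hb, hf, hf.symm ▸ hle, ?_, ?_⟩
  · rw [hf, hb, heq]
  · rw [hb, heq, htight.2]

theorem exists_isFacetBasis (hl : IsFacetFunctional P l) :
    ∃ b : Basis (Fin d) ℝ (Fin d → ℝ), facetForm b = l ∧ IsFacetBasis P b := by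
  have hfin := hP.isCentered.finite_tight (l := l)
  have := hfin.to_subtype
  have e : Fin d ≃ tight P l := (Finite.equivFinOfCardEq (by
    rw [Nat.card_coe_set_eq, (hP.isLatticeBasis_tight hl).ncard_eq hfin])).symm
  have hr : Set.range (fun i => (e i : Fin d → ℝ)) = tight P l :=
    (EquivLike.range_comp Subtype.val e).trans Subtype.range_coe
  obtain ⟨b, -, hb⟩ := hP.exists_isFacetBasis_of_mem_tight hl.le_one (c := fun i => e i)
    (fun i => (e i).2) (by rw [hr, hl.span_tight])
  exact ⟨b, hb⟩

variable {b : Basis (Fin d) ℝ (Fin d → ℝ)}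

/-- Unimodularity of the two facets forces the coordinate of the exchanged vertex to be `±1`. -/
theorem repr_eq_neg_one_of_isFacetBasis {b' : Basis (Fin d) ℝ (Fin d → ℝ)} {i : Fin d}
    {n : Fin d → ℝ} (hb : IsFacetBasis P b) (hb' : IsFacetBasis P b')
    (h : ⇑b' = Function.update b i n) (hneg : b.repr n i < 0) : b.repr n i = -1 := by
  have hn : n ∈ vertices P := by
    simpa [h] using hb'.mem_vertices i
  obtain ⟨k, hk⟩ := hb.exists_int (hP.integral n hn) i
  obtain ⟨m, hm⟩ := exists_int_mul_repr_eq_one (b := b) (i := i) (n := n) <| by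
    rw [← h, hb'.span_eq, ← hb.span_eq]
    exact Submodule.subset_span ⟨i, rfl⟩
  rw [hk] at hm hneg ⊢
  have hmk : m * k = 1 := by exact_mod_cast hm
  have hneg' : k < 0 := by exact_mod_cast hneg
  rcases Int.isUnit_iff.1 (IsUnit.of_mul_eq_one_right m hmk) with rfl | rfl
  · exact absurd hneg' (by decide)
  · simp

theorem exists_isFacetNeighbor (hb : IsFacetBasis P b) (i : Fin d) :
    ∃ n, IsFacetNeighbor P b i n := by
  have hw : -b.coord i ≠ 0 := fun h => by
    simpa using LinearMap.congr_fun h (b i)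
  obtain ⟨t, hle, n, hn, hneg⟩ := hP.isCentered.exists_tight hb.le_one hw
  rw [LinearMap.neg_apply, Basis.coord_apply, neg_pos] at hneg
  have hnb : n ∉ Set.range b := by
    rintro ⟨j, rfl⟩
    rcases eq_or_ne j i with rfl | hj
    · simp [zero_lt_one.not_gt] at hneg
    · simp [hj] at hneg
  have hc : ∀ j, Function.update b i n j ∈ tight P (facetForm b + t • -b.coord i) := by
    intro j
    rcases eq_or_ne j i with rfl | hj
    · rwa [Function.update_self]
    · rw [Function.update_of_ne hj]
      exact ⟨hb.mem_vertices j, by simp [facetForm_self, hj]⟩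
  obtain ⟨b', hb', -, hfacet⟩ :=
    hP.exists_isFacetBasis_of_mem_tight hle hc (span_range_update_eq_top b hneg.ne)
  exact ⟨n, hn.1, hnb, hP.repr_eq_neg_one_of_isFacetBasis hb hfacet hb' hneg, b', hb', hfacet⟩

/-- A facet functional with maximal value at `x` works: passing to the neighbouring facet opposite
to a vertex `b i` would increase the value if the coordinate of `x` at `b i` were negative. -/
theorem exists_isFacetBasis_repr_nonneg (x : Fin d → ℝ) :
    ∃ b : Basis (Fin d) ℝ (Fin d → ℝ), IsFacetBasis P b ∧ ∀ i, 0 ≤ b.repr x i := by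
  obtain ⟨l, hl, hmax⟩ := Set.exists_max_image _ (fun l => l x)
    hP.isCentered.finite_isFacetFunctional hP.isCentered.exists_isFacetFunctional
  obtain ⟨b, rfl, hb⟩ := hP.exists_isFacetBasis hl
  refine ⟨b, hb, fun i => ?_⟩
  obtain ⟨n, hn⟩ := hP.exists_isFacetNeighbor hb i
  obtain ⟨b', hb', hfacet⟩ := hn.exists_isFacetBasis
  have hle := hmax _ hfacet.isFacetFunctional
  rw [facetForm_of_coe_eq_update hb' hn.repr_self] at hle
  simp only [LinearMap.sub_apply, LinearMap.smul_apply, Basis.coord_apply, smul_eq_mul] at hle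
  have hlt := hb.facetForm_lt_one hn.mem_vertices hn.notMem_range
  exact nonneg_of_mul_nonneg_right (by linarith) (sub_pos.2 hlt)

end IsFanoPolyhedron

end Facets

section CoordinateMatrix

variable {d : ℕ} {κ : Type*}

/-- The value of the functional of the base facet at the `k`-th remaining vertex, whose coordinates
are the `k`-th row of `M`. -/
def height (M : κ → Fin d → ℤ) (k : κ) : ℤ := ∑ i, M k i

/-- The conditions satisfied by the coordinates `c` of the remaining vertices at a vertex `x` of the
base facet if the adjacent facet across the ridge that omits `x` is spanned by this ridge and the
`k`-th remaining vertex; `h` is the list of heights. -/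
def IsNeighbor (h c : κ → ℤ) (k : κ) : Prop :=
  c k = -1 ∧ ∀ z, z ≠ k → (1 - h k) * -c z < 1 - h z

variable [DecidableEq κ]

/-- The coordinates of the remaining vertices after exchanging the `i`-th base vertex and the `k`-th
remaining vertex, provided that `M k i = -1`. -/
def pivot (M : κ → Fin d → ℤ) (i : Fin d) (k : κ) : κ → Fin d → ℤ := fun z j =>
  if z = k then if j = i then -1 else M k j
  else if j = i then -M z i else M z j + M z i * M k j

/-- Every facet reached from the base facet by fewer than `n` exchanges has a neighbor across each
of its ridges. -/
def HasNeighbors : ℕ → (κ → Fin d → ℤ) → Prop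
  | 0, _ => True
  | n + 1, M => ∀ i, ∃ k, IsNeighbor (height M) (M · i) k ∧ HasNeighbors n (pivot M i k)

instance [Fintype κ] (h c : κ → ℤ) (k : κ) : Decidable (IsNeighbor h c k) :=
  inferInstanceAs (Decidable (_ ∧ _))

instance decidableHasNeighbors [Fintype κ] :
    ∀ (n : ℕ) (M : κ → Fin d → ℤ), Decidable (HasNeighbors n M)
  | 0, _ => inferInstanceAs (Decidable True)
  | n + 1, M =>
    haveI (i : Fin d) (k : κ) := decidableHasNeighbors n (pivot M i k)
    inferInstanceAs <| Decidable <|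
      ∀ i, ∃ k, IsNeighbor (height M) (M · i) k ∧ HasNeighbors n (pivot M i k)

end CoordinateMatrix

theorem IsFacetBasis.reindex {d : ℕ} {P : Set (Fin d → ℝ)} {b : Basis (Fin d) ℝ (Fin d → ℝ)}
    (hb : IsFacetBasis P b) (π : Equiv.Perm (Fin d)) : IsFacetBasis P (b.reindex π) := by
  have hf : facetForm (b.reindex π) = facetForm b :=
    facetForm_eq fun i => by rw [Basis.reindex_apply, facetForm_self]
  refine ⟨by simpa only [hf] using hb.le_one, ?_, ?_⟩
  · rw [hf, hb.tight_eq, Basis.range_reindex]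
  · rw [Basis.range_reindex, hb.span_eq]

/-- The vertices of `P` are those of a facet with basis `b` and further vertices `o k`, whose
coordinates with respect to `b` are the rows of `M`. -/
structure IsCoordinates {d : ℕ} {κ : Type*} (P : Set (Fin d → ℝ))
    (b : Basis (Fin d) ℝ (Fin d → ℝ)) (o : κ → Fin d → ℝ) (M : κ → Fin d → ℤ) : Prop where
  isFacetBasis : IsFacetBasis P b
  injective : (Sum.elim b o).Injective
  range_eq : Set.range (Sum.elim b o) = vertices P
  repr_eq : ∀ k i, b.repr (o k) i = M k i

namespace IsCoordinates

variable {d : ℕ} {κ : Type*} {P : Set (Fin d → ℝ)} {b : Basis (Fin d) ℝ (Fin d → ℝ)}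
  {o : κ → Fin d → ℝ} {M : κ → Fin d → ℤ}

theorem reindex (h : IsCoordinates P b o M) (π : Equiv.Perm (Fin d)) :
    IsCoordinates P (b.reindex π) o fun k => M k ∘ π.symm := by
  have hcoe : Sum.elim (b.reindex π) o = Sum.elim b o ∘ Equiv.sumCongr π.symm (Equiv.refl κ) := by
    ext1 (i | k) <;> simp
  refine ⟨h.isFacetBasis.reindex π, ?_, ?_, fun k i => ?_⟩
  · exact hcoe ▸ h.injective.comp (Equiv.injective _)
  · rw [hcoe, EquivLike.range_comp, h.range_eq]
  · simp [h.repr_eq]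

theorem comp (h : IsCoordinates P b o M) (τ : Equiv.Perm κ) :
    IsCoordinates P b (o ∘ τ) (M ∘ τ) := by
  have hcoe : Sum.elim b (o ∘ τ) = Sum.elim b o ∘ Equiv.sumCongr (Equiv.refl _) τ := by
    ext1 (i | k) <;> simp
  refine ⟨h.isFacetBasis, ?_, ?_, fun k i => h.repr_eq (τ k) i⟩
  · exact hcoe ▸ h.injective.comp (Equiv.injective _)
  · rw [hcoe, EquivLike.range_comp, h.range_eq]

variable (h : IsCoordinates P b o M)

include h

theorem mem_vertices (k : κ) : o k ∈ vertices P :=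
  h.range_eq ▸ ⟨.inr k, rfl⟩

theorem notMem_range (k : κ) : o k ∉ Set.range b := by
  rintro ⟨i, hi⟩
  exact Sum.inl_ne_inr (h.injective (a₁ := .inl i) (a₂ := .inr k) hi)

theorem eq_sum (k : κ) : o k = ∑ i, (M k i : ℝ) • b i := by
  rw [← b.sum_repr (o k)]
  simp [h.repr_eq]

theorem facetForm_eq_height (k : κ) : facetForm b (o k) = height M k := by
  simp [facetForm_apply, h.repr_eq, height]

theorem height_nonpos (k : κ) : height M k ≤ 0 := by
  have := h.isFacetBasis.facetForm_lt_one (h.mem_vertices k) (h.notMem_range k)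
  rw [h.facetForm_eq_height] at this
  exact Int.lt_add_one_iff.1 (by exact_mod_cast this)

theorem row_ne_zero [NeZero d] (hP : IsCentered P) (k : κ) : M k ≠ 0 := by
  intro h0
  obtain ⟨l, -, hl⟩ := hP.exists_functional_of_mem_vertices (h.mem_vertices k)
  simp [h.eq_sum, h0] at hl

theorem exists_isFacetNeighbor (hP : IsFanoPolyhedron P) (i : Fin d) :
    ∃ k, IsFacetNeighbor P b i (o k) := by
  obtain ⟨n, hn⟩ := hP.exists_isFacetNeighbor h.isFacetBasis i
  obtain ⟨j | k, rfl⟩ := h.range_eq.superset hn.mem_vertices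
  exacts [absurd ⟨j, rfl⟩ hn.notMem_range, ⟨k, hn⟩]

theorem isNeighbor {i : Fin d} {k : κ} (hk : IsFacetNeighbor P b i (o k)) :
    IsNeighbor (height M) (M · i) k := by
  refine ⟨by exact_mod_cast h.repr_eq k i ▸ hk.repr_self, fun z hz => ?_⟩
  have hne : o z ≠ o k := fun hzk =>
    hz (Sum.inr_injective (h.injective (a₁ := .inr z) (a₂ := .inr k) hzk))
  have := hk.mul_neg_repr_lt (h.mem_vertices z) (h.notMem_range z) hne
  rw [h.facetForm_eq_height, h.facetForm_eq_height, h.repr_eq] at this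
  exact_mod_cast this

variable [DecidableEq κ]

theorem exists_pivot {i : Fin d} {k : κ} (hk : IsFacetNeighbor P b i (o k)) :
    ∃ b' o', IsCoordinates P b' o' (pivot M i k) := by
  obtain ⟨b', hb', hfacet⟩ := hk.exists_isFacetBasis
  have hcoe : Sum.elim b' (Function.update o k (b i)) =
      Sum.elim b o ∘ Equiv.swap (.inl i) (.inr k) := by
    ext1 (j | z)
    · rcases eq_or_ne j i with rfl | hj
      · simp [hb']
      · simp [hb', hj, Equiv.swap_apply_of_ne_of_ne]
    · rcases eq_or_ne z k with rfl | hz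
      · simp
      · simp [hz, Equiv.swap_apply_of_ne_of_ne]
  refine ⟨b', Function.update o k (b i), hfacet, ?_, ?_, fun z j => ?_⟩
  · exact hcoe ▸ h.injective.comp (Equiv.injective _)
  · rw [hcoe, EquivLike.range_comp, h.range_eq]
  rw [← Basis.coord_apply]
  rcases eq_or_ne j i with rfl | hj
  · rw [coord_self_of_coe_eq_update hb' hk.repr_self]
    rcases eq_or_ne z k with rfl | hz
    · simp [pivot]
    · simp [pivot, hz, h.repr_eq]
  · rw [coord_of_coe_eq_update hb' hk.repr_self hj]
    rcases eq_or_ne z k with rfl | hz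
    · simp [pivot, hj, h.repr_eq]
    · simp [pivot, hj, hz, h.repr_eq, mul_comm]

omit h in
theorem hasNeighbors (hP : IsFanoPolyhedron P) (n : ℕ) (h : IsCoordinates P b o M) :
    HasNeighbors n M := by
  induction n generalizing b o M with
  | zero => trivial
  | succ n ih =>
    intro i
    obtain ⟨k, hk⟩ := h.exists_isFacetNeighbor hP i
    obtain ⟨b', o', h'⟩ := h.exists_pivot hk
    exact ⟨k, h.isNeighbor hk, ih h'⟩

end IsCoordinates

theorem IsFacetBasis.exists_isCoordinates {d n : ℕ} {P : Set (Fin d → ℝ)}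
    {b : Basis (Fin d) ℝ (Fin d → ℝ)} (hP : IsFanoPolyhedron P)
    (hcard : (vertices P).ncard = d + n) (hb : IsFacetBasis P b) :
    ∃ (o : Fin n → Fin d → ℝ) (M : Fin n → Fin d → ℤ), IsCoordinates P b o M ∧
      Antitone (height M) := by
  have hfin := hP.isCentered.finite_vertices
  have hsub : Set.range b ⊆ vertices P := Set.range_subset_iff.2 hb.mem_vertices
  have hrest : (vertices P \ Set.range b).ncard = n := by
    rw [Set.ncard_sdiff hsub (Set.finite_range b), hcard,
      Set.ncard_range_of_injective b.injective, Nat.card_fin, Nat.add_sub_cancel_left]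
  have := (hfin.subset (Set.sdiff_subset (t := Set.range b))).to_subtype
  have e : Fin n ≃ ↑(vertices P \ Set.range b) :=
    (Finite.equivFinOfCardEq (by rw [Nat.card_coe_set_eq, hrest])).symm
  choose M hM using fun k i => hb.exists_int (hP.integral _ (e k).2.1) i
  have hC : IsCoordinates P b (fun k => (e k : Fin d → ℝ)) M := by
    refine ⟨hb, b.injective.sumElim (Subtype.val_injective.comp e.injective) ?_, ?_, hM⟩
    · exact fun i k hik => (e k).2.2 ⟨i, hik⟩
    · rw [Set.Sum.elim_range]
      change _ ∪ Set.range (Subtype.val ∘ e) = _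
      rw [EquivLike.range_comp, Subtype.range_coe, Set.union_sdiff_cancel hsub]
  refine ⟨_, _, hC.comp (Tuple.sort fun k => -height M k), fun k l hkl => ?_⟩
  exact neg_le_neg_iff.1 (Tuple.monotone_sort (fun k => -height M k) hkl)

/-- The base facet is chosen such that its cone contains the sum of all vertices. -/
theorem IsFanoPolyhedron.exists_isCoordinates {d n : ℕ} {P : Set (Fin d → ℝ)}
    (hP : IsFanoPolyhedron P) (hcard : (vertices P).ncard = d + n) :
    ∃ (b : Basis (Fin d) ℝ (Fin d → ℝ)) (o : Fin n → Fin d → ℝ) (M : Fin n → Fin d → ℤ),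
      IsCoordinates P b o M ∧ Antitone (height M) ∧ ∀ i, -1 ≤ ∑ k, M k i := by
  obtain ⟨b, hb, hnonneg⟩ :=
    hP.exists_isFacetBasis_repr_nonneg (∑ v ∈ hP.isCentered.finite_vertices.toFinset, v)
  obtain ⟨o, M, hC, hheight⟩ := hb.exists_isCoordinates hP hcard
  refine ⟨b, o, M, hC, hheight, fun i => ?_⟩
  have hset : hP.isCentered.finite_vertices.toFinset =
      Finset.univ.map ⟨Sum.elim b o, hC.injective⟩ := by
    ext x
    simp [← hC.range_eq]
  have hsum := hnonneg i
  rw [hset, Finset.sum_map, Fintype.sum_sum_type] at hsum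
  simp only [Function.Embedding.coeFn_mk, Sum.elim_inl, Sum.elim_inr, map_add, map_sum,
    Basis.repr_self, Finsupp.coe_add, Finsupp.coe_finsetSum, Pi.add_apply, Finset.sum_apply,
    hC.repr_eq, Finsupp.single_apply, Finset.sum_ite_eq', Finset.mem_univ, if_true] at hsum
  have : 0 ≤ 1 + ∑ k, M k i := by exact_mod_cast hsum
  linarith

section FamiliesWithSum

variable {A : Type*} [AddCommGroup A] [DecidableEq A]

/-- The families of `n + 1` members of `C`, in the order of `C`, with sum `r`, provided that the
weight `w` is at least `-1` on `C`. -/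
def familiesWithSum (w : A →+ ℤ) : (n : ℕ) → A → List A → List (Fin (n + 1) → A)
  | 0, r, C => if r ∈ C then [![r]] else []
  | n + 1, r, C => C.tails.flatMap fun
    | [] => []
    | c :: C' =>
      if -(n + 1 : ℤ) ≤ w (r - c) then
        (familiesWithSum w n (r - c) (c :: C')).map (Matrix.vecCons c)
      else []

theorem vecCons_mem_familiesWithSum {w : A →+ ℤ} {n : ℕ} {r c : A} {C C' : List A}
    {f : Fin (n + 1) → A} (hC : c :: C' <:+ C) (hw : -(n + 1 : ℤ) ≤ w (r - c))
    (hf : f ∈ familiesWithSum w n (r - c) (c :: C')) :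
    Matrix.vecCons c f ∈ familiesWithSum w (n + 1) r C := by
  refine List.mem_flatMap.2 ⟨_, (List.mem_tails _ _).2 hC, ?_⟩
  simpa only [if_pos hw] using List.mem_map_of_mem hf

omit [AddCommGroup A] [DecidableEq A] in
theorem exists_cons_suffix {ι : Type*} [Nonempty ι] {C : List A} {f : ι → A} (hf : ∀ i, f i ∈ C) :
    ∃ i C', f i :: C' <:+ C ∧ ∀ j, f j ∈ f i :: C' := by
  induction C with
  | nil => simp at hf
  | cons c C ih =>
    by_cases hc : ∃ i, f i = c
    · obtain ⟨i, rfl⟩ := hc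
      exact ⟨i, C, List.suffix_rfl, hf⟩
    · obtain ⟨i, C', hC, hmem⟩ := ih fun j => (List.mem_cons.1 (hf j)).resolve_left (hc ⟨j, ·⟩)
      exact ⟨i, C', hC.trans (List.suffix_cons c C), hmem⟩

theorem exists_perm_mem_familiesWithSum {w : A →+ ℤ} {n : ℕ} {C : List A}
    (hw : ∀ c ∈ C, -1 ≤ w c) {f : Fin (n + 1) → A} (hf : ∀ i, f i ∈ C) :
    ∃ π : Equiv.Perm (Fin (n + 1)), f ∘ π ∈ familiesWithSum w n (∑ i, f i) C := by
  induction n generalizing C with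
  | zero =>
    refine ⟨1, ?_⟩
    have h : f ∘ (1 : Equiv.Perm (Fin 1)) = ![∑ i, f i] := by
      ext i
      simp [Subsingleton.elim i 0]
    simp only [h, familiesWithSum, if_pos (show ∑ i, f i ∈ C by simpa using hf 0),
      List.mem_singleton]
  | succ n ih =>
    obtain ⟨i, C', hsuffix, hmem⟩ := exists_cons_suffix hf
    let g : Fin (n + 1) → A := fun j => f (Equiv.swap 0 i j.succ)
    have hsum : ∑ j, g j = ∑ j, f j - f i := by
      have h := Fin.sum_univ_succ fun j => f (Equiv.swap 0 i j)
      rw [Equiv.sum_comp (Equiv.swap 0 i) f, Equiv.swap_apply_left] at h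
      exact eq_sub_of_add_eq' h.symm
    obtain ⟨π, hπ⟩ :=
      ih (fun c hc => hw c (hsuffix.subset hc)) fun j => hmem (Equiv.swap 0 i j.succ)
    rw [hsum] at hπ
    have hle : -(n + 1 : ℤ) ≤ w (∑ j, f j - f i) := by
      rw [← hsum, map_sum]
      simpa using Finset.card_nsmul_le_sum Finset.univ (fun j => w (g j)) (-1) fun j _ =>
        hw _ (hf _)
    refine ⟨Equiv.Perm.decomposeFin.symm (i, π), ?_⟩
    convert vecCons_mem_familiesWithSum hsuffix hle hπ using 1
    ext1 j
    refine Fin.cases ?_ (fun j => ?_) j <;> simp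

end FamiliesWithSum

/-- A facet of each combinatorial type, used as coordinate frame. -/
def CombType.base : CombType → Fin 4 → Fin 7
  | .D => ![1, 2, 4, 6]
  | .E => ![1, 6, 3, 4]
  | .G => ![2, 3, 5, 6]

/-- Coordinates of `v₃, v₅, v₇` with respect to `v₁, v₂, v₄, v₆`. -/
def coordsD : Fin 19 → Fin 3 → Fin 4 → ℤ :=
  ![![![-1, -1, 0, 2], ![0, 0, -1, 1], ![0, 0, 0, -1]],
    ![![-1, -1, 2, 0], ![0, 0, -1, 1], ![0, 0, 0, -1]],
    ![![-1, -1, 1, 1], ![0, 0, -1, 1], ![0, 0, 0, -1]],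
    ![![-1, -1, 0, 2], ![1, 0, -1, 0], ![0, 0, 0, -1]],
    ![![-1, -1, 2, 0], ![0, 0, -1, 0], ![0, 0, 0, -1]],
    ![![-1, -1, 0, 1], ![0, 0, -1, 1], ![0, 0, 0, -1]],
    ![![-1, -1, 0, 0], ![1, 0, -1, 0], ![1, 0, 0, -1]],
    ![![-1, -1, 1, 0], ![0, 0, -1, 1], ![0, 0, 0, -1]],
    ![![-1, -1, 1, 1], ![0, 0, -1, 0], ![0, 0, 0, -1]],
    ![![-1, -1, 0, 1], ![1, 0, -1, 0], ![0, 0, 0, -1]],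
    ![![-1, -1, 0, 0], ![1, 0, -1, 0], ![0, 0, 1, -1]],
    ![![-1, -1, 1, 0], ![0, 0, -1, 0], ![0, 0, 0, -1]],
    ![![-1, -1, 0, 0], ![0, 0, -1, 0], ![0, 0, 0, -1]],
    ![![-1, -1, 0, 0], ![0, 0, -1, 0], ![1, 0, 0, -1]],
    ![![-1, -1, 0, 0], ![0, 0, -1, 0], ![0, 0, 1, -1]],
    ![![-1, -1, 1, -1], ![0, 0, -1, 1], ![0, 0, 0, -1]],
    ![![-1, -1, 0, 0], ![1, 0, -1, 0], ![0, 1, 0, -1]],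
    ![![-1, -1, 0, -2], ![0, 0, -1, 1], ![0, 0, 0, -1]],
    ![![-1, -1, 0, -1], ![0, 0, -1, 1], ![0, 0, 0, -1]]]

/-- Coordinates of `v₂, v₅, v₇` with respect to `v₁, v₆, v₃, v₄`. -/
def coordsE : Fin 3 → Fin 3 → Fin 4 → ℤ :=
  ![![![-1, 1, 0, 0], ![3, -1, -1, -1], ![-1, 0, 0, 0]],
    ![![-1, 1, 0, 0], ![2, -1, -1, -1], ![-1, 0, 0, 0]],
    ![![-1, 1, 0, 0], ![1, -1, -1, -1], ![-1, 0, 0, 0]]]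

/-- Coordinates of `v₁, v₄, v₇` with respect to `v₂, v₃, v₅, v₆`. -/
def coordsG : Fin 6 → Fin 3 → Fin 4 → ℤ :=
  ![![![-1, -1, 1, 1], ![-2, -2, 1, 1], ![1, 1, -1, -1]],
    ![![-1, -1, 0, 0], ![-2, -2, -1, -1], ![-1, -1, -1, -1]],
    ![![-1, -1, 1, 1], ![-1, -1, 0, 0], ![1, 1, -1, -1]],
    ![![-1, -1, 0, 0], ![0, -1, -1, -1], ![1, 0, -1, -1]],
    ![![-1, -1, 0, 0], ![0, 0, -1, -1], ![1, 1, -1, -1]],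
    ![![-1, -1, 0, 0], ![-1, -1, -1, -1], ![0, 0, -1, -1]]]

/-- Vectors realizing the relations of `a`, normalized on the base facet. -/
def Name.stdVec : Name → Fin 7 → Fin 4 → ℤ
  | .D i => ![coordsD i 2, ![1, 0, 0, 0], ![0, 1, 0, 0], coordsD i 0, ![0, 0, 1, 0],
      coordsD i 1, ![0, 0, 0, 1]]
  | .E i => ![coordsE i 2, ![1, 0, 0, 0], coordsE i 0, ![0, 0, 1, 0], ![0, 0, 0, 1],
      coordsE i 1, ![0, 1, 0, 0]]
  | .G i => ![coordsG i 2, coordsG i 0, ![1, 0, 0, 0], ![0, 1, 0, 0], coordsG i 1,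
      ![0, 0, 1, 0], ![0, 0, 0, 1]]

section Enumeration

/-- The entries of a column of three integers. -/
def entry (c : ℤ × ℤ × ℤ) : Fin 3 → ℤ := ![c.1, c.2.1, c.2.2]

/-- The sum of the entries of a column of three integers. -/
def total : ℤ × ℤ × ℤ →+ ℤ := AddMonoidHom.mk' (fun c => c.1 + c.2.1 + c.2.2) fun c c' => by
  simp only [Prod.fst_add, Prod.snd_add]
  ring

/-- The columns of a matrix with three rows, as triples: the enumeration below is evaluated by the
kernel, which handles triples much faster than functions on `Fin 3`. -/
def column {d : ℕ} (M : Fin 3 → Fin d → ℤ) (i : Fin d) : ℤ × ℤ × ℤ := (M 0 i, M 1 i, M 2 i)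

/-- The entries that may occur in a row of height `h` of a matrix with four columns. -/
def entriesOfHeight (h : ℤ) : List ℤ :=
  (List.range (5 - 3 * h).toNat).map fun n : ℕ => h - 1 + n

/-- The columns that may occur in a matrix with four columns and the given heights. -/
def columnsOfHeights (h : ℤ × ℤ × ℤ) : List (ℤ × ℤ × ℤ) :=
  (entriesOfHeight h.1 ×ˢ entriesOfHeight h.2.1 ×ˢ entriesOfHeight h.2.2).filter fun c =>
    -1 ≤ total c ∧ total c ≤ total h + 3 ∧ ∃ k, IsNeighbor (entry h) (entry c) k

/-- The possible heights of three vertices in decreasing order. -/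
def heightsList : List (ℤ × ℤ × ℤ) :=
  [(0, 0, 0), (0, 0, -1), (0, 0, -2), (0, 0, -3), (0, 0, -4), (0, -1, -1), (0, -1, -2),
   (0, -1, -3), (0, -2, -2), (-1, -1, -1), (-1, -1, -2)]

/-- The coordinates of all vertices: the unit vectors, followed by the rows of `M`. -/
def frame {d n : ℕ} (M : Fin n → Fin d → ℤ) : Fin (d + n) → Fin d → ℤ :=
  Fin.append (fun i => Pi.single i 1) M

/-- The vertices with coordinates `frame M`, renumbered by `σ`, satisfy the same linear relations as
the vectors `a.stdVec`. -/
def Matches (M : Fin 3 → Fin 4 → ℤ) (a : Name) (σ : Fin 7 → Fin 7) : Prop :=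
  (∀ j m, frame M (σ j) m = ∑ i, a.stdVec j i * frame M (σ (a.type.base i)) m) ∧ σ.Injective

instance (M : Fin 3 → Fin 4 → ℤ) (a : Name) (σ : Fin 7 → Fin 7) : Decidable (Matches M a σ) :=
  inferInstanceAs (Decidable (_ ∧ _))

/-- The names and numberings that occur in the enumeration, found by computer search. -/
def matchTable : List (Name × (Fin 7 → Fin 7)) :=
  [(.D 0, ![6, 0, 1, 4, 2, 5, 3]), (.D 0, ![6, 1, 2, 5, 0, 4, 3]), (.D 1, ![6, 0, 1, 4, 3, 5, 2]),
   (.D 1, ![6, 1, 2, 5, 0, 4, 3]), (.D 2, ![6, 0, 1, 4, 2, 5, 3]), (.D 2, ![6, 1, 2, 5, 0, 4, 3]),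
   (.D 3, ![6, 1, 0, 4, 2, 5, 3]), (.D 3, ![6, 3, 1, 5, 0, 4, 2]), (.D 4, ![5, 0, 1, 4, 3, 6, 2]),
   (.D 4, ![6, 0, 1, 4, 3, 5, 2]), (.D 5, ![5, 1, 2, 6, 0, 4, 3]), (.D 5, ![6, 1, 2, 5, 0, 4, 3]),
   (.D 6, ![5, 3, 2, 6, 0, 4, 1]), (.D 7, ![5, 1, 2, 6, 0, 4, 3]), (.D 7, ![6, 1, 2, 5, 0, 4, 3]),
   (.D 8, ![6, 0, 1, 4, 2, 5, 3]), (.D 9, ![5, 3, 2, 6, 0, 4, 1]), (.D 9, ![6, 3, 1, 5, 0, 4, 2]),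
   (.D 10, ![4, 2, 1, 6, 3, 5, 0]), (.D 10, ![5, 3, 2, 6, 0, 4, 1]),
   (.D 11, ![4, 1, 2, 5, 3, 6, 0]), (.D 11, ![4, 2, 3, 6, 1, 5, 0]),
   (.D 11, ![5, 0, 1, 4, 3, 6, 2]), (.D 11, ![5, 2, 3, 6, 0, 4, 1]),
   (.D 11, ![6, 0, 1, 4, 3, 5, 2]), (.D 11, ![6, 1, 2, 5, 0, 4, 3]),
   (.D 12, ![5, 2, 3, 6, 0, 4, 1]), (.D 13, ![4, 3, 2, 6, 1, 5, 0]),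
   (.D 14, ![4, 1, 2, 6, 3, 5, 0]), (.D 15, ![2, 0, 1, 4, 3, 6, 5]),
   (.D 15, ![5, 1, 2, 6, 0, 4, 3]), (.D 16, ![4, 2, 3, 6, 1, 5, 0]),
   (.D 17, ![3, 0, 1, 4, 2, 6, 5]), (.D 18, ![0, 1, 2, 5, 3, 6, 4]),
   (.D 18, ![3, 0, 1, 4, 2, 6, 5]), (.D 18, ![5, 1, 2, 6, 0, 4, 3]),
   (.E 0, ![6, 0, 4, 1, 2, 5, 3]), (.E 0, ![6, 3, 5, 0, 1, 4, 2]), (.E 1, ![5, 0, 4, 1, 2, 6, 3]),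
   (.E 1, ![6, 0, 4, 1, 2, 5, 3]), (.E 2, ![4, 5, 3, 1, 2, 6, 0]), (.E 2, ![5, 0, 4, 1, 2, 6, 3]),
   (.E 2, ![5, 4, 0, 1, 2, 6, 3]), (.G 0, ![6, 1, 0, 4, 5, 2, 3]), (.G 0, ![6, 3, 2, 5, 4, 0, 1]),
   (.G 1, ![4, 0, 2, 6, 3, 1, 5]), (.G 1, ![5, 3, 2, 6, 1, 0, 4]), (.G 2, ![4, 5, 2, 3, 6, 0, 1]),
   (.G 2, ![5, 0, 1, 4, 6, 2, 3]), (.G 2, ![5, 4, 0, 1, 6, 2, 3]), (.G 2, ![6, 1, 0, 4, 5, 2, 3]),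
   (.G 3, ![0, 4, 1, 5, 3, 2, 6]), (.G 3, ![0, 4, 2, 6, 3, 1, 5]), (.G 3, ![4, 0, 2, 6, 3, 1, 5]),
   (.G 3, ![5, 2, 3, 6, 1, 0, 4]), (.G 4, ![0, 4, 1, 5, 3, 2, 6]), (.G 4, ![1, 6, 2, 3, 5, 0, 4]),
   (.G 5, ![0, 4, 1, 5, 3, 2, 6])]

set_option maxRecDepth 100000 in
theorem exists_matches_of_mem_familiesWithSum : ∀ h ∈ heightsList,
    ∀ F ∈ familiesWithSum total 3 h (columnsOfHeights h),
      (∀ k, ∃ i, entry (F i) k ≠ 0) → HasNeighbors 3 (fun k i => entry (F i) k) →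
        ∃ p ∈ matchTable, Matches (fun k i => entry (F i) k) p.1 p.2 := by
  decide +kernel

end Enumeration

theorem apply_le_sum_sub {ι : Type*} [Fintype ι] {f : ι → ℤ} {m : ℤ} (hf : ∀ i, m ≤ f i) (i : ι) :
    f i ≤ ∑ j, f j - (Fintype.card ι - 1) * m := by
  classical
  have hle := Finset.card_nsmul_le_sum (Finset.univ.erase i) f m fun j _ => hf j
  rw [Finset.card_erase_of_mem (Finset.mem_univ i), Finset.card_univ, nsmul_eq_mul,
    Nat.cast_pred (Fintype.card_pos_iff.2 ⟨i⟩)] at hle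
  linarith [Finset.add_sum_erase Finset.univ f (Finset.mem_univ i)]

theorem height_sub_one_le {d : ℕ} {κ : Type*} {M : κ → Fin d → ℤ} (hh : ∀ k, height M k ≤ 0)
    {i : Fin d} (hN : ∃ k, IsNeighbor (height M) (M · i) k) (k : κ) :
    height M k - 1 ≤ M k i := by
  obtain ⟨n, hn, hlt⟩ := hN
  rcases eq_or_ne k n with rfl | hkn
  · linarith [hh k]
  · by_contra! hneg
    nlinarith [hlt k hkn, hh n, hh k]

section Completeness

variable {M : Fin 3 → Fin 4 → ℤ} (hh : ∀ k, height M k ≤ 0) (hs : ∀ i, -1 ≤ ∑ k, M k i)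

theorem entry_column (i : Fin 4) : entry (column M i) = (M · i) := by
  ext k
  fin_cases k <;> rfl

theorem total_eq_sum_entry (c : ℤ × ℤ × ℤ) : total c = ∑ k, entry c k := by
  simp [total, entry, Fin.sum_univ_three, add_assoc]

theorem entry_sum_column : entry (∑ i, column M i) = height M := by
  ext k
  simp only [height]
  fin_cases k <;> simp [entry, column, Prod.fst_sum, Prod.snd_sum]

theorem mem_entriesOfHeight {h z : ℤ} (h₁ : h - 1 ≤ z) (h₂ : z ≤ 3 - 2 * h) :
    z ∈ entriesOfHeight h :=
  List.mem_map.2 ⟨(z - (h - 1)).toNat, List.mem_range.2 (by lia), by lia⟩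

include hh in
theorem mem_entriesOfHeight_height (hN : ∀ i, ∃ k, IsNeighbor (height M) (M · i) k) (k : Fin 3)
    (i : Fin 4) : M k i ∈ entriesOfHeight (height M k) := by
  have hle := fun j => height_sub_one_le hh (hN j) k
  refine mem_entriesOfHeight (hle i) ?_
  have hupper := apply_le_sum_sub hle i
  rw [← height, Fintype.card_fin] at hupper
  norm_num at hupper
  linarith

include hs in
theorem neg_one_le_total_column (i : Fin 4) : -1 ≤ total (column M i) := by
  rw [total_eq_sum_entry, entry_column]
  exact hs i

include hh hs in
theorem column_mem_columnsOfHeights (hN : ∀ i, ∃ k, IsNeighbor (height M) (M · i) k) (i : Fin 4) :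
    column M i ∈ columnsOfHeights (∑ i, column M i) := by
  have hmem := mem_entriesOfHeight_height hh hN
  rw [← entry_sum_column] at hmem
  have htotal := neg_one_le_total_column hs
  have hle := apply_le_sum_sub htotal i
  norm_num [← map_sum] at hle
  refine List.mem_filter.2 ⟨?_, decide_eq_true ⟨htotal i, hle, ?_⟩⟩
  · exact List.mem_product.2 ⟨hmem 0 i, List.mem_product.2 ⟨hmem 1 i, hmem 2 i⟩⟩
  · rw [entry_sum_column, entry_column]
    exact hN i

include hh hs in
theorem sum_column_mem_heightsList (hmono : Antitone (height M)) :
    ∑ i, column M i ∈ heightsList := by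
  have htotal : -4 ≤ total (∑ i, column M i) := by
    rw [map_sum]
    simpa using Finset.card_nsmul_le_sum Finset.univ _ _ fun i _ => neg_one_le_total_column hs i
  have h₀ := hh 0
  have h₁ := hmono (show (0 : Fin 3) ≤ 1 by decide)
  have h₂ := hmono (show (1 : Fin 3) ≤ 2 by decide)
  rw [← entry_sum_column] at h₀ h₁ h₂
  generalize ∑ i, column M i = h at *
  obtain ⟨x, y, z⟩ := h
  simp only [total, AddMonoidHom.mk'_apply, entry, Matrix.cons_val] at htotal h₀ h₁ h₂
  simp only [heightsList, List.mem_cons, Prod.mk.injEq, List.not_mem_nil, or_false]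
  obtain rfl | rfl : x = 0 ∨ x = -1 := by lia
  all_goals obtain rfl | rfl | rfl : y = 0 ∨ y = -1 ∨ y = -2 := by lia
  all_goals lia

end Completeness

theorem IsCoordinates.exists_matches {P : Set (Fin 4 → ℝ)} {b : Basis (Fin 4) ℝ (Fin 4 → ℝ)}
    {o : Fin 3 → Fin 4 → ℝ} {M : Fin 3 → Fin 4 → ℤ} (hP : IsFanoPolyhedron P)
    (h : IsCoordinates P b o M) (hmono : Antitone (height M)) (hs : ∀ i, -1 ≤ ∑ k, M k i) :
    ∃ (π : Equiv.Perm (Fin 4)) (a : Name) (σ : Fin 7 → Fin 7),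
      Matches (fun k => M k ∘ π) a σ := by
  have hN : ∀ i, ∃ k, IsNeighbor (height M) (M · i) k := fun i =>
    let ⟨k, hk⟩ := h.exists_isFacetNeighbor hP i
    ⟨k, h.isNeighbor hk⟩
  obtain ⟨π, hπ⟩ := exists_perm_mem_familiesWithSum (fun c hc => ((of_decide_eq_true
    (List.mem_filter.1 hc).2).1 : -1 ≤ total c)) (column_mem_columnsOfHeights h.height_nonpos hs hN)
  have hM : (fun k i => entry ((column M ∘ π) i) k) = fun k => M k ∘ π := by
    ext k i
    exact congrFun (entry_column (π i)) k
  have h' : IsCoordinates P _ _ fun k => M k ∘ π := h.reindex π.symm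
  obtain ⟨⟨a, σ⟩, -, hmatch⟩ := exists_matches_of_mem_familiesWithSum _
    (sum_column_mem_heightsList h.height_nonpos hs hmono) _ hπ
    (fun k => by
      obtain ⟨i, hi⟩ := Function.ne_iff.1 (h'.row_ne_zero hP.isCentered k)
      exact ⟨i, congrFun (congrFun hM k) i ▸ hi⟩)
    (hM ▸ h'.hasNeighbors hP 3)
  exact ⟨π, a, σ, hM ▸ hmatch⟩

namespace IsCoordinates

variable {d n : ℕ} {P : Set (Fin d → ℝ)} {b : Basis (Fin d) ℝ (Fin d → ℝ)} {o : Fin n → Fin d → ℝ}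
  {M : Fin n → Fin d → ℤ}

theorem append_eq_sum (h : IsCoordinates P b o M) (j : Fin (d + n)) :
    Fin.append b o j = ∑ i, (frame M j i : ℝ) • b i := by
  refine Fin.addCases (fun i => ?_) (fun k => ?_) j
  · simp [frame, Pi.single_apply]
  · simpa [frame] using h.eq_sum k

theorem range_append (h : IsCoordinates P b o M) : Set.range (Fin.append b o) = vertices P := by
  rw [← h.range_eq, ← Fin.append_comp_sumElim]
  exact (EquivLike.range_comp (Fin.append b o) finSumFinEquiv).symm

end IsCoordinates

/-- The vectors with the coordinates `a.stdVec` with respect to `b`. -/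
def Name.vec {V : Type*} [AddCommGroup V] (a : Name) (b : Fin 4 → V) : Fin 7 → V :=
  Fintype.linearCombination ℤ b ∘ a.stdVec

/-- `b` is a basis of the lattice with respect to which the vertices of `P` have the coordinates
`a.stdVec`. -/
structure IsStdBasis (P : Set (Fin 4 → ℝ)) (a : Name) (b : Fin 4 → Fin 4 → ℝ) : Prop where
  span_eq : Submodule.span ℤ (Set.range b) = stdLattice 4
  range_vec : Set.range (a.vec b) = vertices P

theorem Name.vec_mem_span {V : Type*} [AddCommGroup V] (a : Name) (b : Fin 4 → V) (j : Fin 7) :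
    a.vec b j ∈ Submodule.span ℤ (Set.range b) :=
  (Fintype.range_linearCombination ℤ b).le ⟨_, rfl⟩

theorem IsFanoPolyhedron.exists_isStdBasis {P : Set (Fin 4 → ℝ)} (hP : IsFanoPolyhedron P)
    (hcard : (vertices P).ncard = 7) : ∃ a b, IsStdBasis P a b := by
  obtain ⟨b, o, M, hC, hmono, hs⟩ := hP.exists_isCoordinates (n := 3) hcard
  obtain ⟨π, a, σ, hmatch, hσ⟩ := hC.exists_matches hP hmono hs
  have hC' : IsCoordinates P (b.reindex π.symm) o fun k => M k ∘ π := hC.reindex π.symm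
  set v := Fin.append (b.reindex π.symm) o ∘ σ with hv
  have hvec : a.vec (v ∘ a.type.base) = v := by
    ext1 j
    simp only [Name.vec, Fintype.linearCombination_apply, hv, Function.comp_apply,
      hC'.append_eq_sum, hmatch j, Finset.smul_sum]
    rw [Finset.sum_comm]
    simp only [Int.cast_sum, Int.cast_mul, ← smul_smul, Finset.sum_smul, Int.cast_smul_eq_zsmul]
  have hrange : Set.range v = vertices P :=
    ((Finite.surjective_of_injective hσ).range_comp _).trans hC'.range_append
  refine ⟨a, v ∘ a.type.base, le_antisymm (Submodule.span_le.2 ?_) ?_, hvec.symm ▸ hrange⟩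
  · rintro _ ⟨i, rfl⟩
    exact hP.integral _ (hrange.subset ⟨_, rfl⟩)
  · rw [← hC'.isFacetBasis.span_eq, Submodule.span_le]
    rintro _ ⟨i, rfl⟩
    obtain ⟨j, hj⟩ := hrange.superset (hC'.isFacetBasis.mem_vertices i)
    rw [← hj]
    exact congrFun hvec j ▸ a.vec_mem_span (v ∘ a.type.base) j

section Realization

theorem det_sub_vecMulVec_one {n R : Type*} [Fintype n] [DecidableEq n] [CommRing R]
    {A : Matrix n n R} {u : n → R} (hu : A.mulVec u = 1) (w : n → R) :
    (A - Matrix.vecMulVec 1 w).det = A.det * (1 - w ⬝ᵥ u) := by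
  have h : A - Matrix.vecMulVec 1 w = A * (1 - Matrix.vecMulVec u w) := by
    rw [Matrix.mul_sub, Matrix.mul_one, Matrix.mul_vecMulVec, hu]
  rw [h, Matrix.det_mul, Matrix.vecMulVec_eq Unit, Matrix.det_one_sub_mul_comm]
  simp

theorem span_range_sum_smul_eq {n R M : Type*} [Fintype n] [DecidableEq n] [CommRing R]
    [AddCommGroup M] [Module R M] {A : Matrix n n R} (hA : IsUnit A.det) (b : n → M) :
    Submodule.span R (Set.range fun i => ∑ k, A i k • b k) = Submodule.span R (Set.range b) := by
  refine le_antisymm (Submodule.span_le.2 ?_) (Submodule.span_le.2 ?_)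
  · rintro _ ⟨i, rfl⟩
    exact Submodule.sum_mem _ fun k _ => Submodule.smul_mem _ _ (Submodule.subset_span ⟨k, rfl⟩)
  · rintro _ ⟨m, rfl⟩
    have h : b m = ∑ i, A⁻¹ m i • ∑ k, A i k • b k := by
      simp only [Finset.smul_sum, smul_smul]
      rw [Finset.sum_comm]
      simp only [← Finset.sum_smul, ← Matrix.mul_apply, Matrix.nonsing_inv_mul A hA,
        Matrix.one_apply, ite_smul, one_smul, zero_smul, Finset.sum_ite_eq, Finset.mem_univ,
        if_true]
    rw [h]
    exact Submodule.sum_mem _ fun i _ => Submodule.smul_mem _ _ (Submodule.subset_span ⟨i, rfl⟩)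

/-- The second determinant is the first one times `1 - l (v j)`, where `l` is the linear functional
with value `1` on the vectors `v (f i)`. -/
theorem isFaceSet_image_of_det_pos {d : ℕ} {ι : Type*} [DecidableEq ι] {b : Fin d → Fin d → ℝ}
    (hb : LinearIndependent ℝ b) {s : ι → Fin d → ℤ} {f : Fin d → ι}
    (hdet : (Matrix.of fun i => s (f i)).det ≠ 0)
    (hpos : ∀ j, (∀ i, f i ≠ j) →
      0 < (Matrix.of fun i => s (f i)).det * (Matrix.of fun i => s (f i) - s j).det) :
    IsFaceSet (fun j => ∑ i, s j i • b i) (Finset.univ.image f) := by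
  set A := (Matrix.of fun i => s (f i)).map (Int.cast : ℤ → ℝ)
  have hdetA : A.det = ((Matrix.of fun i => s (f i)).det : ℤ) :=
    ((Int.castRingHom ℝ).map_det _).symm
  have hA : IsUnit A.det := by
    rw [hdetA]
    exact isUnit_iff_ne_zero.2 (by exact_mod_cast hdet)
  obtain ⟨l, hl⟩ := exists_linearMap_apply_eq hb (A⁻¹.mulVec 1)
  have hu : A.mulVec (A⁻¹.mulVec 1) = 1 := by
    rw [Matrix.mulVec_mulVec, Matrix.mul_nonsing_inv A hA, Matrix.one_mulVec]
  have hval : ∀ j, l (∑ i, s j i • b i) = (fun i => (s j i : ℝ)) ⬝ᵥ A⁻¹.mulVec 1 := by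
    intro j
    rw [map_sum]
    exact Finset.sum_congr rfl fun i _ => by rw [map_zsmul, hl, zsmul_eq_mul]
  have hone : ∀ i, l (∑ k, s (f i) k • b k) = 1 := fun i => (hval _).trans (congrFun hu i)
  have hlt : ∀ j, (∀ i, f i ≠ j) → l (∑ k, s j k • b k) < 1 := fun j hj => by
    have h : (((Matrix.of fun i => s (f i) - s j).det : ℤ) : ℝ) =
        A.det * (1 - l (∑ k, s j k • b k)) := by
      rw [hval, ← det_sub_vecMulVec_one hu]
      refine ((Int.castRingHom ℝ).map_det _).trans (congrArg Matrix.det ?_)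
      ext i k
      simp [A]
    have h' : 0 < A.det * (A.det * (1 - l (∑ k, s j k • b k))) := by
      rw [← h, hdetA]
      exact_mod_cast hpos j hj
    rw [← mul_assoc] at h'
    exact sub_pos.1 (pos_of_mul_pos_right h' (mul_self_nonneg _))
  refine ⟨l, fun j => ?_, fun j => ?_⟩ <;> by_cases hj : ∃ i, f i = j
  · obtain ⟨i, rfl⟩ := hj
    exact (hone i).le
  · exact (hlt j (not_exists.1 hj)).le
  · obtain ⟨i, rfl⟩ := hj
    simpa using hone i
  · simpa [hj] using (hlt j (not_exists.1 hj)).ne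

variable {d : ℕ} {ι : Type*} {v : ι → Fin d → ℝ}

theorem isFanoPolyhedron_convexHull_range [Finite ι]
    (h0 : (0 : Fin d → ℝ) ∈ interior (convexHull ℝ (Set.range v))) (hv : ∀ j, IsFaceSet v {j})
    (h : ∀ S, IsFaceSet v S → ∃ f : Fin d → ι, (S : Set ι) ⊆ Set.range f ∧
      Submodule.span ℤ (Set.range (v ∘ f)) = stdLattice d) :
    IsFanoPolyhedron (convexHull ℝ (Set.range v)) := by
  classical
  have hvert := vertices_convexHull_range h0 hv
  have hC : IsCentered (convexHull ℝ (Set.range v)) := ⟨⟨_, Set.finite_range v, rfl⟩, h0⟩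
  let w : ι ↪ (Fin d → ℝ) := ⟨v, injective_of_isFaceSet_singleton hv⟩
  have hw : Set.range w = vertices (convexHull ℝ (Set.range v)) := hvert.symm
  have hface : ∀ F, IsProperFace (convexHull ℝ (Set.range v)) F → ∃ f : Fin d → ι,
      vertices F ⊆ Set.range (v ∘ f) ∧ LinearIndependent ℝ (v ∘ f) ∧
        Submodule.span ℤ (Set.range (v ∘ f)) = stdLattice d := by
    intro F hF
    obtain ⟨S, hS, hFS⟩ := hC.exists_isFaceSet_of_isProperFace hw hF
    obtain ⟨f, hSf, hf⟩ := h S hS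
    refine ⟨f, ?_, linearIndependent_of_stdLattice_le_span hf.ge, hf⟩
    rw [hFS, Set.range_comp]
    exact Set.image_mono hSf
  have hsimp : IsSimplicial (convexHull ℝ (Set.range v)) := ⟨hC, fun F hF => by
    obtain ⟨f, hFf, hli, -⟩ := hface F hF
    exact (hli.affineIndependent.range).mono hFf⟩
  refine ⟨hC.polytope, ?_, h0, hsimp.affineIndependent, fun F k hk hF => ?_⟩
  · rw [hvert]
    rintro _ ⟨j, rfl⟩
    obtain ⟨f, hjf, hf⟩ := h {j} (hv j)
    obtain ⟨i, rfl⟩ := hjf (Finset.mem_coe.2 (Finset.mem_singleton_self j))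
    exact hf ▸ Submodule.subset_span ⟨i, rfl⟩
  · have hFP : F ≠ convexHull ℝ (Set.range v) := by
      rintro rfl
      have := hC.finrank_vectorSpan
      have := hF.2.2
      omega
    obtain ⟨f, hFf, hli, hf⟩ := hface F ⟨hF.1, hFP⟩
    have hcard : (Set.range (v ∘ f)).ncard ≤ (vertices F).ncard := by
      rw [← hsimp.finrank_vectorSpan_add_one ⟨hF.1, hFP⟩ hF.2.1, hF.2.2, hk, ← Set.image_univ]
      exact (Set.ncard_image_le).trans (by simp)
    rw [Set.eq_of_subset_of_ncard_le hFf hcard (Set.finite_range _)]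
    exact ⟨(hli.restrict_scalars' ℤ).linearIndepOn_id, hf⟩

end Realization

section Certificates

/-- The vertex sets of the facets of each combinatorial type. -/
def CombType.facets : CombType → List (Fin 4 → Fin 7)
  | .D => [![1, 2, 4, 6], ![1, 2, 4, 7], ![1, 2, 5, 6], ![1, 2, 5, 7], ![1, 3, 4, 6],
      ![1, 3, 4, 7], ![1, 3, 5, 6], ![1, 3, 5, 7], ![2, 3, 4, 6], ![2, 3, 4, 7],
      ![2, 3, 5, 6], ![2, 3, 5, 7]]
  | .E => [![1, 3, 4, 5], ![1, 6, 3, 4], ![1, 3, 5, 6], ![1, 4, 5, 6], ![2, 3, 4, 6],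
      ![2, 3, 4, 7], ![2, 3, 5, 6], ![2, 3, 5, 7], ![2, 4, 5, 6], ![2, 4, 5, 7],
      ![3, 4, 5, 7]]
  | .G => [![1, 2, 4, 5], ![1, 2, 4, 6], ![1, 2, 5, 6], ![1, 3, 4, 5], ![1, 3, 4, 6],
      ![1, 3, 5, 6], ![2, 3, 5, 6], ![2, 3, 5, 7], ![2, 3, 6, 7], ![2, 4, 5, 7],
      ![2, 4, 6, 7], ![3, 4, 5, 7], ![3, 4, 6, 7]]

/-- The sets of indices of the faces: those that contain none of the primitive collections. -/
def CombType.Free (t : CombType) (S : Finset (Fin 7)) : Prop :=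
  ∀ C ∈ t.collections, ¬ C ⊆ S

instance (t : CombType) : DecidablePred t.Free := fun _ => List.decidableBAll _ _

theorem CombType.exists_mem_facets {t : CombType} {S : Finset (Fin 7)} (h : t.Free S) :
    ∃ f ∈ t.facets, S ⊆ Finset.univ.image f := by
  cases t <;> revert S <;> decide +kernel

theorem CombType.free_singleton (t : CombType) (j : Fin 7) : t.Free {j} := by
  cases t <;> revert j <;> decide +kernel

theorem CombType.eq_of_subset_of_mem_collections {t : CombType} {C D : Finset (Fin 7)}
    (hC : C ∈ t.collections) (hD : D ∈ t.collections) (h : C ⊆ D) : C = D := by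
  have key : ∀ C ∈ t.collections, ∀ D ∈ t.collections, C ⊆ D → C = D := by
    cases t <;> decide +kernel
  exact key C hC D hD h

theorem CombType.mem_collections_iff_minimal {t : CombType} {S : Finset (Fin 7)} :
    S ∈ t.collections ↔ Minimal (fun T => ¬ t.Free T) S := by
  have hfree : ∀ {C}, C ∈ t.collections → ¬ t.Free C := fun hC h => h _ hC subset_rfl
  constructor
  · refine fun hS => ⟨hfree hS, fun T hT hTS => ?_⟩
    simp only [CombType.Free, not_forall, not_not] at hT
    obtain ⟨C, hC, hCT⟩ := hT
    exact eq_of_subset_of_mem_collections hC hS (hCT.trans hTS) ▸ hCT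
  · intro hS
    have h := hS.1
    simp only [CombType.Free, not_forall, not_not] at h
    obtain ⟨C, hC, hCS⟩ := h
    exact hCS.antisymm (hS.2 (hfree hC) hCS) ▸ hC

namespace Name

/-- The names as a disjoint union of three finite types. -/
def equivSum : Name ≃ Fin 19 ⊕ Fin 3 ⊕ Fin 6 where
  toFun
    | .D i => .inl i
    | .E i => .inr (.inl i)
    | .G i => .inr (.inr i)
  invFun
    | .inl i => .D i
    | .inr (.inl i) => .E i
    | .inr (.inr i) => .G i
  left_inv a := by cases a <;> rfl
  right_inv x := by obtain i | i | i := x <;> rfl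

instance : Fintype Name := Fintype.ofEquiv _ equivSum.symm

theorem exists_mem_relations_iff (a : Name) (S : Finset (Fin 7)) :
    (∃ r ∈ a.relations, r.1 = S) ↔ S ∈ a.type.collections := by
  cases a <;> simp [relations, type, CombType.collections, eq_comm]

/-- Coefficients of a positive linear relation between the vectors `a.stdVec`. The first
coefficient is that of the vector with the number `7`. -/
def posCoeff : Name → Fin 7 → ℤ
  | .D i => posCoeffD i
  | .E i => posCoeffE i
  | .G i => posCoeffG i
where
  posCoeffD : Fin 19 → Fin 7 → ℤ :=
    ![![4, 1, 1, 1, 1, 1, 1], ![4, 1, 1, 1, 1, 3, 1], ![4, 1, 1, 1, 1, 2, 1],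
      ![5, 1, 2, 2, 1, 1, 1], ![1, 1, 1, 1, 1, 3, 1], ![3, 1, 1, 1, 1, 1, 1],
      ![1, 1, 3, 3, 1, 1, 1], ![3, 1, 1, 1, 1, 2, 1], ![2, 1, 1, 1, 1, 2, 1],
      ![3, 1, 2, 2, 1, 1, 1], ![1, 1, 3, 3, 1, 2, 1], ![1, 1, 1, 1, 1, 2, 1],
      ![1, 1, 1, 1, 1, 1, 1], ![1, 1, 2, 2, 1, 1, 1], ![1, 1, 1, 1, 1, 2, 1],
      ![2, 1, 1, 1, 1, 2, 1], ![1, 1, 1, 2, 1, 1, 1], ![1, 1, 1, 1, 1, 1, 2],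
      ![1, 1, 1, 1, 1, 1, 1]]
  posCoeffE : Fin 3 → Fin 7 → ℤ :=
    ![![6, 1, 1, 2, 2, 2, 1], ![4, 1, 1, 2, 2, 2, 1], ![2, 1, 1, 2, 2, 2, 1]]
  posCoeffG : Fin 6 → Fin 7 → ℤ :=
    ![![4, 1, 1, 1, 2, 1, 1], ![1, 1, 4, 4, 1, 2, 2], ![2, 1, 1, 1, 2, 1, 1],
      ![1, 2, 1, 3, 1, 2, 2], ![1, 2, 1, 1, 1, 2, 2], ![1, 1, 2, 2, 1, 2, 2]]

theorem posCoeff_pos : ∀ (a : Name) (j : Fin 7), 0 < a.posCoeff j := by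
  decide +kernel

theorem sum_posCoeff_smul_stdVec : ∀ a : Name, ∑ j, a.posCoeff j • a.stdVec j = 0 := by
  decide +kernel

theorem sum_stdVec : ∀ a : Name, ∀ r ∈ a.relations,
    ∑ j ∈ r.1, a.stdVec j = (r.2.map a.stdVec).sum := by
  decide +kernel

theorem card_lt_of_mem_relations : ∀ a : Name, ∀ r ∈ a.relations, r.2.card < r.1.card := by
  decide +kernel

theorem free_of_mem_relations :
    ∀ a : Name, ∀ r ∈ a.relations, a.type.Free r.2.toFinset := by
  decide +kernel

/-- The coordinates of the vectors with the numbers `f`. -/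
def facetMatrix (a : Name) (f : Fin 4 → Fin 7) : Matrix (Fin 4) (Fin 4) ℤ :=
  Matrix.of fun i => a.stdVec (f i)

set_option maxRecDepth 100000 in
theorem forall_facets_det : ∀ a : Name, a.type.facets.Forall fun f =>
    (a.facetMatrix f).det ^ 2 = 1 ∧ ∀ j, (∀ i, f i ≠ j) →
      0 < (a.facetMatrix f).det * (Matrix.of fun i => a.stdVec (f i) - a.stdVec j).det := by
  decide +kernel

variable {a : Name} {f : Fin 4 → Fin 7}

theorem isUnit_det_facetMatrix (hf : f ∈ a.type.facets) : IsUnit (a.facetMatrix f).det :=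
  isUnit_iff_exists_inv.2
    ⟨_, (sq _).symm.trans (List.forall_iff_forall_mem.1 (forall_facets_det a) f hf).1⟩

theorem det_facetMatrix_mul_pos (hf : f ∈ a.type.facets) {j : Fin 7} (hj : ∀ i, f i ≠ j) :
    0 < (a.facetMatrix f).det * (Matrix.of fun i => a.stdVec (f i) - a.stdVec j).det :=
  (List.forall_iff_forall_mem.1 (forall_facets_det a) f hf).2 j hj

end Name

end Certificates

section StandardVectors

namespace Name

variable {V : Type*} [AddCommGroup V] (a : Name) (b : Fin 4 → V)

theorem map_vec {W : Type*} [AddCommGroup W] (g : V →+ W) (j : Fin 7) :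
    g (a.vec b j) = a.vec (g ∘ b) j := by
  simp only [vec, Fintype.linearCombination_apply, Function.comp_apply, map_sum, map_zsmul]

theorem sum_vec {r : Finset (Fin 7) × Multiset (Fin 7)} (hr : r ∈ a.relations) :
    ∑ j ∈ r.1, a.vec b j = (r.2.map (a.vec b)).sum := by
  simp only [vec, Function.comp_def]
  rw [← map_sum, a.sum_stdVec r hr, map_multiset_sum, Multiset.map_map]
  rfl

theorem sum_posCoeff_smul_vec : ∑ j, a.posCoeff j • a.vec b j = 0 := by
  simp only [vec, Function.comp_apply, ← map_zsmul, ← map_sum, sum_posCoeff_smul_stdVec, map_zero]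

variable {a}

theorem span_range_vec_comp {f : Fin 4 → Fin 7} (hf : f ∈ a.type.facets) :
    Submodule.span ℤ (Set.range (a.vec b ∘ f)) = Submodule.span ℤ (Set.range b) :=
  span_range_sum_smul_eq (isUnit_det_facetMatrix hf) b

variable {b : Fin 4 → Fin 4 → ℝ}

theorem free_of_isFaceSet {S : Finset (Fin 7)} (hS : IsFaceSet (a.vec b) S) : a.type.Free S := by
  intro C hC hCS
  obtain ⟨r, hr, rfl⟩ := (a.exists_mem_relations_iff C).2 hC
  obtain ⟨l, hle, hl⟩ := hS
  have hsum := congrArg l (a.sum_vec b hr)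
  rw [map_sum, Finset.sum_congr rfl fun j hj => (hl j).2 (hCS hj), map_multiset_sum,
    Multiset.map_map] at hsum
  have hcard : (r.2.map (l ∘ a.vec b)).sum ≤ r.2.card := by
    simpa using Multiset.sum_map_le_sum_map _ (fun _ => (1 : ℝ)) fun j _ => hle j
  have hlt : (r.2.card : ℝ) < r.1.card := by exact_mod_cast a.card_lt_of_mem_relations r hr
  rw [Finset.sum_const, nsmul_one] at hsum
  linarith

theorem isFaceSet_vec_iff (hb : Submodule.span ℤ (Set.range b) = stdLattice 4)
    {S : Finset (Fin 7)} : IsFaceSet (a.vec b) S ↔ a.type.Free S := by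
  refine ⟨free_of_isFaceSet, fun hS => ?_⟩
  obtain ⟨f, hf, hSf⟩ := CombType.exists_mem_facets hS
  have hli : LinearIndependent ℝ (a.vec b ∘ f) :=
    linearIndependent_of_stdLattice_le_span ((span_range_vec_comp b hf).trans hb).ge
  have hface : IsFaceSet (a.vec b) (Finset.univ.image f) :=
    isFaceSet_image_of_det_pos (linearIndependent_of_stdLattice_le_span hb.ge)
      (isUnit_det_facetMatrix hf).ne_zero fun j hj => det_facetMatrix_mul_pos hf hj
  refine hface.mono ?_ hSf
  choose g hg using fun j : Finset.univ.image f => (Finset.mem_image.1 j.2)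
  have hgf : (fun j : Finset.univ.image f => a.vec b j) = (a.vec b ∘ f) ∘ g :=
    funext fun j => congrArg _ (hg j).2.symm
  rw [hgf]
  exact hli.comp g fun i j hij => Subtype.ext ((hg i).2 ▸ (hg j).2 ▸ congrArg f hij)

theorem vec_injective (hb : Submodule.span ℤ (Set.range b) = stdLattice 4) :
    (a.vec b).Injective :=
  injective_of_isFaceSet_singleton fun j => (isFaceSet_vec_iff hb).2 (a.type.free_singleton j)

theorem zero_mem_interior_convexHull_range_vec
    (hb : Submodule.span ℤ (Set.range b) = stdLattice 4) :
    (0 : Fin 4 → ℝ) ∈ interior (convexHull ℝ (Set.range (a.vec b))) := by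
  refine zero_mem_interior_convexHull (c := fun j => (a.posCoeff j : ℝ))
    (fun j => by exact_mod_cast a.posCoeff_pos j) ?_ ?_
  · simpa only [Int.cast_smul_eq_zsmul] using a.sum_posCoeff_smul_vec b
  · obtain ⟨f, hf, -⟩ := CombType.exists_mem_facets (a.type.free_singleton 0)
    refine span_eq_top_of_stdLattice_le_span ?_
    rw [← hb, ← span_range_vec_comp b hf]
    exact Submodule.span_mono (Set.range_comp_subset_range f _)

theorem isFanoPolyhedron_convexHull_range_vec
    (hb : Submodule.span ℤ (Set.range b) = stdLattice 4) :
    IsFanoPolyhedron (convexHull ℝ (Set.range (a.vec b))) := by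
  refine isFanoPolyhedron_convexHull_range (zero_mem_interior_convexHull_range_vec hb)
    (fun j => (isFaceSet_vec_iff hb).2 (a.type.free_singleton j)) fun S hS => ?_
  obtain ⟨f, hf, hSf⟩ := CombType.exists_mem_facets (free_of_isFaceSet hS)
  refine ⟨f, ?_, (span_range_vec_comp b hf).trans hb⟩
  simpa using Finset.coe_subset.2 hSf

end Name

end StandardVectors

section LatticeAutomorphism

variable {d : ℕ}

theorem exists_linearEquiv_coe_eq_act (A : GL (Fin d) ℤ) :
    ∃ e : (Fin d → ℝ) ≃ₗ[ℝ] (Fin d → ℝ), ⇑e = act A.val :=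
  ⟨(Matrix.GeneralLinearGroup.toLin
    (Matrix.GeneralLinearGroup.map (Int.castRingHom ℝ) A)).toLinearEquiv, rfl⟩

theorem span_range_linearEquiv_comp_eq_iff {ι R M : Type*} [Semiring R] [AddCommMonoid M]
    [Module R M] (e : M ≃ₗ[R] M) (b : ι → M) :
    Submodule.span R (Set.range (e ∘ b)) = Submodule.span R (Set.range b) ↔
      ∀ x, e x ∈ Submodule.span R (Set.range b) ↔ x ∈ Submodule.span R (Set.range b) := by
  have h (x : M) :
      e x ∈ Submodule.span R (Set.range (e ∘ b)) ↔ x ∈ Submodule.span R (Set.range b) := by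
    rw [Set.range_comp]
    exact (Submodule.map_span e.toLinearMap (Set.range b)) ▸ e.injective.mem_set_image
  refine ⟨fun heq x => heq ▸ h x, fun hmem => ?_⟩
  ext y
  obtain ⟨x, rfl⟩ := e.surjective y
  rw [h, hmem]

theorem act_mem_stdLattice (A : Matrix (Fin d) (Fin d) ℤ) {x : Fin d → ℝ}
    (hx : x ∈ stdLattice d) : act A x ∈ stdLattice d := by
  choose n hn using mem_stdLattice_iff.1 hx
  obtain rfl : x = Int.cast ∘ n := funext hn
  exact mem_stdLattice_iff.2 fun i =>
    ⟨A.mulVec n i, ((Int.castRingHom ℝ).map_mulVec A n i).symm⟩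

theorem exists_act_eq {f : (Fin d → ℝ) →ₗ[ℝ] (Fin d → ℝ)}
    (hf : ∀ x ∈ stdLattice d, f x ∈ stdLattice d) :
    ∃ A : Matrix (Fin d) (Fin d) ℤ, act A = f := by
  choose A hA using fun i j => mem_stdLattice_iff.1
    (hf _ (Submodule.subset_span (Set.mem_range_self j))) i
  have h : (Matrix.of A).map (Int.cast : ℤ → ℝ) = LinearMap.toMatrix' f := by
    ext i j
    simp [LinearMap.toMatrix'_apply, ← hA]
  refine ⟨Matrix.of A, funext fun x => ?_⟩
  rw [act, h, ← Matrix.toLin'_apply, Matrix.toLin'_toMatrix']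

theorem exists_generalLinear_act_eq {e : (Fin d → ℝ) ≃ₗ[ℝ] (Fin d → ℝ)}
    (he : ∀ x, e x ∈ stdLattice d ↔ x ∈ stdLattice d) : ∃ A : GL (Fin d) ℤ, act A.val = e := by
  obtain ⟨A, hA⟩ := exists_act_eq (f := e) fun x hx => (he x).2 hx
  obtain ⟨B, hB⟩ := exists_act_eq (f := e.symm) fun x hx => (he _).1 (by simpa using hx)
  have hact : act (A * B) = act 1 := funext fun x => by simp [act_mul, act_one, hA, hB]
  have hAB : A * B = 1 := Matrix.map_injective Int.cast_injective (Matrix.mulVec_injective hact)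
  exact ⟨⟨A, B, hAB, mul_eq_one_comm.1 hAB⟩, hA⟩

theorem exists_generalLinear_comp_eq {b c : Fin d → Fin d → ℝ}
    (hb : Submodule.span ℤ (Set.range b) = stdLattice d)
    (hc : Submodule.span ℤ (Set.range c) = stdLattice d) :
    ∃ A : GL (Fin d) ℤ, act A.val ∘ b = c := by
  let B := Basis.mk (linearIndependent_of_stdLattice_le_span hb.ge)
    (span_eq_top_of_stdLattice_le_span hb.ge).ge
  let C := Basis.mk (linearIndependent_of_stdLattice_le_span hc.ge)
    (span_eq_top_of_stdLattice_le_span hc.ge).ge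
  let e := B.equiv C (Equiv.refl _)
  have hbc : e ∘ b = c := funext fun i => by
    simpa [e, B, C] using B.equiv_apply i C (Equiv.refl _)
  have he := (span_range_linearEquiv_comp_eq_iff (e.restrictScalars ℤ) b).1
    ((congrArg (fun f => Submodule.span ℤ (Set.range f)) hbc).trans (hc.trans hb.symm))
  rw [hb] at he
  obtain ⟨A, hA⟩ := exists_generalLinear_act_eq he
  exact ⟨A, hA ▸ hbc⟩

theorem act_mem_stdLattice_iff (A : GL (Fin d) ℤ) {x : Fin d → ℝ} :
    act A.val x ∈ stdLattice d ↔ x ∈ stdLattice d := by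
  refine ⟨fun hx => ?_, act_mem_stdLattice A.val⟩
  simpa [← act_mul, act_one] using act_mem_stdLattice A⁻¹.val hx

theorem span_range_act_comp (A : GL (Fin d) ℤ) {b : Fin d → Fin d → ℝ}
    (hb : Submodule.span ℤ (Set.range b) = stdLattice d) :
    Submodule.span ℤ (Set.range (act A.val ∘ b)) = stdLattice d := by
  obtain ⟨e, he⟩ := exists_linearEquiv_coe_eq_act A
  rw [← he, ← hb]
  refine (span_range_linearEquiv_comp_eq_iff (e.restrictScalars ℤ) b).2 fun x => ?_
  rw [hb]
  exact he ▸ act_mem_stdLattice_iff A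

end LatticeAutomorphism

section CombinatorialEquivalence

variable {d n : ℕ} {P Q : FanoPolyhedron d n} {v : Fin n ↪ (Fin d → ℝ)}

theorem exists_perm_trans_eq {α β : Type*} {v w : α ↪ β} (h : Set.range v = Set.range w) :
    ∃ σ : Equiv.Perm α, σ.toEmbedding.trans w = v :=
  ⟨(Equiv.ofInjective v v.injective).trans
    ((Equiv.setCongr h).trans (Equiv.ofInjective w w.injective).symm),
    Function.Embedding.ext fun j => Equiv.apply_ofInjective_symm w.injective ⟨v j, h ▸ ⟨j, rfl⟩⟩⟩

/-- The bijection between the numbers and the vertices given by a numbering. -/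
noncomputable def IsNumbering.equiv (hv : IsNumbering P v) : Fin n ≃ vertices P.1 :=
  (Equiv.ofInjective v v.injective).trans (Equiv.setCongr hv)

theorem IsNumbering.val_image_equiv_image (hv : IsNumbering P v) (S : Set (Fin n)) :
    Subtype.val '' (hv.equiv '' S) = v '' S :=
  Set.image_image _ _ _

theorem combinatoriallyEquivalent_iff_exists_isNumbering (hv : IsNumbering P v) :
    CombinatoriallyEquivalent P Q ↔ ∃ w, IsNumbering Q w ∧
      ∀ S : Set (Fin n), IsSimplexFace P.1 (v '' S) ↔ IsSimplexFace Q.1 (w '' S) := by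
  constructor
  · rintro ⟨ρ, hρ⟩
    refine ⟨(hv.equiv.trans ρ).toEmbedding.trans (Function.Embedding.subtype _), ?_, fun S => ?_⟩
    · exact ((hv.equiv.trans ρ).surjective.range_comp _).trans Subtype.range_val
    · rw [← hv.val_image_equiv_image, hρ, Set.image_image, Set.image_image]
      rfl
  · rintro ⟨w, hw, h⟩
    refine ⟨hv.equiv.symm.trans hw.equiv, fun S => ?_⟩
    obtain ⟨T, rfl⟩ := hv.equiv.surjective.image_surjective S
    rw [hv.val_image_equiv_image, h, ← hw.val_image_equiv_image, Set.image_image]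
    simp [Set.image_image]

theorem forall_isSimplexFace_iff [NeZero d] (hn : n ≠ d + 1) {w : Fin n ↪ (Fin d → ℝ)}
    (hv : IsNumbering P v) (hw : IsNumbering Q w) :
    (∀ S : Set (Fin n), IsSimplexFace P.1 (v '' S) ↔ IsSimplexFace Q.1 (w '' S)) ↔
      ∀ S : Finset (Fin n), IsPrimitiveCollection P.1 (S.map v) ↔
        IsPrimitiveCollection Q.1 (S.map w) := by
  have hP := P.2.1.isSimplicial
  have hQ := Q.2.1.isSimplicial
  have hcard : Fintype.card (Fin n) ≠ d + 1 := by rwa [Fintype.card_fin]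
  simp only [hP.isPrimitiveCollection_map_iff hv, hQ.isPrimitiveCollection_map_iff hw]
  constructor
  · intro h S
    have hface : ∀ T : Finset (Fin n), IsFaceSet v T ↔ IsFaceSet w T := fun T => by
      rcases T.eq_empty_or_nonempty with rfl | hT
      · exact iff_of_true ⟨0, by simp⟩ ⟨0, by simp⟩
      · simpa [hT, hP.isSimplexFace_image_iff hv hcard, hQ.isSimplexFace_image_iff hw hcard]
          using h T
    simp only [hface]
  · intro h S
    obtain ⟨T, rfl⟩ := S.toFinite.exists_finset_coe
    rw [hP.isSimplexFace_image_iff hv hcard, hQ.isSimplexFace_image_iff hw hcard,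
      hP.isFaceSet_iff_forall_minimal hv, hQ.isFaceSet_iff_forall_minimal hw]
    simp only [h]

end CombinatorialEquivalence

section Invariants

/-- The action of a permutation of the indices on pairs of a set and a multiset of indices, such
as the relations of a `Name`. -/
def renumber {ι : Type*} (σ : Equiv.Perm ι) : Equiv.Perm (Finset ι × Multiset ι) :=
  σ.finsetCongr.prodCongr
    { toFun := Multiset.map σ
      invFun := Multiset.map σ.symm
      left_inv := fun R => by simp
      right_inv := fun R => by simp }

theorem renumber_apply {ι : Type*} (σ : Equiv.Perm ι) (r : Finset ι × Multiset ι) :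
    renumber σ r = (r.1.map σ.toEmbedding, r.2.map σ) := rfl

/-- A number attached to a pair of relations that does not depend on the numbering of the
vertices. It is chosen such that `Name.code` separates the names. -/
def pairCode {ι : Type*} [DecidableEq ι] (r s : Finset ι × Multiset ι) : ℕ :=
  (s.1.card + 2 * s.2.card + r.2.countP (· ∈ s.1) + 3 * r.2.countP (· ∈ s.2)) ^ 2

theorem pairCode_renumber {ι : Type*} [DecidableEq ι] (σ : Equiv.Perm ι)
    (r s : Finset ι × Multiset ι) : pairCode (renumber σ r) (renumber σ s) = pairCode r s := by
  rw [renumber_apply, renumber_apply, pairCode, Multiset.countP_map, Multiset.countP_map]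
  simp [pairCode, Multiset.countP_eq_card_filter]

/-- An invariant of a system of relations under renumbering of the vertices. -/
def Name.code (a : Name) : ℕ :=
  ∑ r ∈ a.relations.toFinset, ∑ s ∈ a.relations.toFinset, pairCode r s

/-- An invariant of a system of primitive collections under renumbering of the vertices. -/
def CombType.code (t : CombType) : ℕ :=
  ∑ S ∈ t.collections.toFinset, S.card ^ 2

set_option maxRecDepth 100000 in
theorem Name.code_injective : Function.Injective Name.code := by
  have h : Function.Injective (Name.code ∘ Name.equivSum.symm) := by decide +kernel
  exact (Equiv.injective_comp _ _).1 h

theorem CombType.code_injective : Function.Injective CombType.code := by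
  intro s t h
  cases s <;> cases t <;> first | rfl | exact absurd h (by decide +kernel)

theorem Name.eq_of_renumber {a c : Name} (σ : Equiv.Perm (Fin 7))
    (h : ∀ r, r ∈ a.relations ↔ renumber σ r ∈ c.relations) : a = c :=
  code_injective <| Finset.sum_equiv (renumber σ) (by simpa using h) fun r _ =>
    Finset.sum_equiv (renumber σ) (by simpa using h) fun s _ => (pairCode_renumber σ r s).symm

theorem CombType.eq_of_perm {s t : CombType} (σ : Equiv.Perm (Fin 7))
    (h : ∀ S, S ∈ s.collections ↔ S.map σ.toEmbedding ∈ t.collections) : s = t :=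
  code_injective <| Finset.sum_equiv σ.finsetCongr (by simpa using h) fun S _ => by simp

end Invariants

section Classification

variable {P Q : FanoPolyhedron 4 7} {a c : Name} {s t : CombType} {b : Fin 4 → Fin 4 → ℝ}

theorem IsStdBasis.describedBy (h : IsStdBasis P.1 a b) : DescribedBy P a := by
  have hP := P.2.1.isSimplicial
  let v : Fin 7 ↪ (Fin 4 → ℝ) := ⟨a.vec b, Name.vec_injective h.span_eq⟩
  have hv : Set.range v = vertices P.1 := h.range_vec
  have hface : ∀ S, IsFaceSet v S ↔ a.type.Free S := fun S => Name.isFaceSet_vec_iff h.span_eq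
  refine ⟨v, hv, fun S => ?_, fun r hr => ?_⟩
  · simp only [hP.isPrimitiveCollection_map_iff hv, hface, Name.exists_mem_relations_iff,
      CombType.mem_collections_iff_minimal]
  · simp only [hP.isPrimitiveRelation_map_iff hv, hface, ← CombType.mem_collections_iff_minimal]
    exact ⟨(a.exists_mem_relations_iff _).1 ⟨r, hr, rfl⟩, a.free_of_mem_relations r hr,
      a.sum_vec b hr⟩

theorem DescribedBy.hasType (h : DescribedBy P a) : HasType P a.type :=
  let ⟨v, hv, hS, _⟩ := h
  ⟨v, hv, fun S => (hS S).trans (a.exists_mem_relations_iff S)⟩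

theorem DescribedBy.exists_isNumbering (h : DescribedBy P a) :
    ∃ v, IsNumbering P v ∧
      ∀ r, r ∈ a.relations ↔ IsPrimitiveRelation P.1 (r.1.map v) (r.2.map v) := by
  obtain ⟨v, hv, hS, hr⟩ := h
  refine ⟨v, hv, fun r => ⟨hr r, fun h => ?_⟩⟩
  obtain ⟨r', hr', heq⟩ := (hS r.1).1 h.1
  obtain rfl : r' = r := Prod.ext heq (P.2.1.isSimplicial.eq_of_isPrimitiveRelation_map hv
    (hr r' hr') (heq ▸ h))
  exact hr'

theorem DescribedBy.eq (ha : DescribedBy P a) (hc : DescribedBy P c) : a = c := by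
  obtain ⟨v, hv, hva⟩ := ha.exists_isNumbering
  obtain ⟨w, hw, hwc⟩ := hc.exists_isNumbering
  obtain ⟨σ, rfl⟩ := exists_perm_trans_eq (hv.trans hw.symm)
  refine Name.eq_of_renumber σ fun r => ?_
  rw [hva, hwc]
  simp [renumber, Finset.map_map]

theorem HasType.eq (hs : HasType P s) (ht : HasType P t) : s = t := by
  obtain ⟨v, hv, hvs⟩ := hs
  obtain ⟨w, hw, hwt⟩ := ht
  obtain ⟨σ, rfl⟩ := exists_perm_trans_eq (hv.trans hw.symm)
  exact CombType.eq_of_perm σ fun S => by rw [← hvs, ← hwt, Finset.map_map]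

theorem Name.image_vec (A : GL (Fin 4) ℤ) (a : Name) (b : Fin 4 → Fin 4 → ℝ) :
    act A.val '' Set.range (a.vec b) = Set.range (a.vec (act A.val ∘ b)) := by
  obtain ⟨e, he⟩ := exists_linearEquiv_coe_eq_act A
  rw [← he, ← Set.range_comp]
  exact congrArg Set.range (funext (a.map_vec b (e : (Fin 4 → ℝ) →+ (Fin 4 → ℝ))))

theorem IsStdBasis.image_act {P : Set (Fin 4 → ℝ)} (h : IsStdBasis P a b) (A : GL (Fin 4) ℤ) :
    IsStdBasis (act A.val '' P) a (act A.val ∘ b) := by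
  refine ⟨span_range_act_comp A h.span_eq, ?_⟩
  rw [← Name.image_vec, h.range_vec]
  obtain ⟨e, he⟩ := exists_linearEquiv_coe_eq_act A
  exact he ▸ image_extremePoints e P

theorem IsStdBasis.isomorphic {b' : Fin 4 → Fin 4 → ℝ} (hP : IsStdBasis P.1 a b)
    (hQ : IsStdBasis Q.1 a b') : Isomorphic P Q := by
  obtain ⟨A, rfl⟩ := exists_generalLinear_comp_eq hP.span_eq hQ.span_eq
  obtain ⟨e, he⟩ := exists_linearEquiv_coe_eq_act A
  refine ⟨A, ?_⟩
  rw [← P.2.1.isCentered.convexHull_vertices, ← Q.2.1.isCentered.convexHull_vertices,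
    ← hP.range_vec, ← hQ.range_vec, ← Name.image_vec, ← he]
  exact e.toLinearMap.image_convexHull _

theorem FanoPolyhedron.exists_isStdBasis (P : FanoPolyhedron 4 7) : ∃ a b, IsStdBasis P.1 a b :=
  P.2.1.exists_isStdBasis P.2.2

theorem existsUnique_describedBy (P : FanoPolyhedron 4 7) : ∃! a, DescribedBy P a :=
  let ⟨a, _, h⟩ := P.exists_isStdBasis
  ⟨a, h.describedBy, fun _ hc => hc.eq h.describedBy⟩

theorem existsUnique_hasType (P : FanoPolyhedron 4 7) : ∃! t, HasType P t :=
  let ⟨_, h, _⟩ := existsUnique_describedBy P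
  ⟨_, h.hasType, fun _ ht => ht.eq h.hasType⟩

theorem DescribedBy.exists_isStdBasis (h : DescribedBy P a) : ∃ b, IsStdBasis P.1 a b := by
  obtain ⟨c, b, hb⟩ := P.exists_isStdBasis
  exact ⟨b, h.eq hb.describedBy ▸ hb⟩

theorem DescribedBy.isomorphic_iff (ha : DescribedBy P a) (hc : DescribedBy Q c) :
    Isomorphic P Q ↔ a = c := by
  obtain ⟨b, hb⟩ := ha.exists_isStdBasis
  constructor
  · rintro ⟨A, hA⟩
    exact (hA ▸ hb.image_act A : IsStdBasis Q.1 a _).describedBy.eq hc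
  · rintro rfl
    obtain ⟨b', hb'⟩ := hc.exists_isStdBasis
    exact hb.isomorphic hb'

theorem HasType.combinatoriallyEquivalent_iff (ht : HasType P t) :
    CombinatoriallyEquivalent P Q ↔ HasType Q t := by
  obtain ⟨v, hv, h⟩ := ht
  rw [combinatoriallyEquivalent_iff_exists_isNumbering hv]
  refine exists_congr fun w => and_congr_right fun hw => ?_
  rw [forall_isSimplexFace_iff (by norm_num) hv hw]
  exact forall_congr' fun S => by rw [h]; exact ⟨Iff.symm, Iff.symm⟩

theorem exists_describedBy (a : Name) : ∃ P : FanoPolyhedron 4 7, DescribedBy P a := by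
  have hb : Submodule.span ℤ (Set.range (Pi.basisFun ℝ (Fin 4))) = stdLattice 4 := rfl
  have hP := Name.isFanoPolyhedron_convexHull_range_vec (a := a) hb
  have hvert : Set.range (a.vec (Pi.basisFun ℝ (Fin 4))) =
      vertices (convexHull ℝ (Set.range (a.vec (Pi.basisFun ℝ (Fin 4))))) :=
    (vertices_convexHull_range hP.zero_mem
      fun j => (Name.isFaceSet_vec_iff hb).2 (a.type.free_singleton j)).symm
  refine ⟨⟨_, hP, ?_⟩, IsStdBasis.describedBy ⟨hb, hvert⟩⟩
  rw [← hvert, ← Set.image_univ, Set.ncard_image_of_injective _ (Name.vec_injective hb)]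
  simp

end Classification

section Counting

/-- The isomorphism class of the polyhedra described by `a`. -/
noncomputable def Name.isoClass (a : Name) : IsoClass 4 7 :=
  (exists_describedBy a).choose.isoClass

theorem DescribedBy.isoClass_eq {P : FanoPolyhedron 4 7} {a : Name} (h : DescribedBy P a) :
    a.isoClass = P.isoClass :=
  Quotient.sound (((exists_describedBy a).choose_spec.isomorphic_iff h).2 rfl)

theorem Name.isoClass_bijective : Function.Bijective Name.isoClass := by
  refine ⟨fun a c h => ?_, fun q => ?_⟩
  · exact ((exists_describedBy a).choose_spec.isomorphic_iff (exists_describedBy c).choose_spec).1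
      (Quotient.exact h)
  · obtain ⟨P, rfl⟩ := Quotient.exists_rep q
    obtain ⟨a, h, -⟩ := existsUnique_describedBy P
    exact ⟨a, h.isoClass_eq⟩

theorem image_isoClass_setOf_type_eq (t : CombType) :
    Name.isoClass '' {a | a.type = t} = classesOfType t := by
  ext q
  constructor
  · rintro ⟨a, rfl, rfl⟩
    obtain ⟨P, h⟩ := exists_describedBy a
    exact ⟨P, h.isoClass_eq.symm, h.hasType⟩
  · rintro ⟨P, rfl, ht⟩
    obtain ⟨a, h, -⟩ := existsUnique_describedBy P
    exact ⟨a, h.hasType.eq ht, h.isoClass_eq⟩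

theorem card_isoClass : Nat.card (IsoClass 4 7) = 28 := by
  rw [← Nat.card_eq_of_bijective _ Name.isoClass_bijective, Nat.card_congr Name.equivSum]
  simp

instance : DecidableEq CombType := CombType.code_injective.decidableEq

theorem ncard_classesOfType (t : CombType) :
    (classesOfType t).ncard = Fintype.card {a : Name // a.type = t} := by
  rw [← image_isoClass_setOf_type_eq, Set.ncard_image_of_injective _ Name.isoClass_bijective.1,
    ← Nat.card_coe_set_eq, Nat.card_eq_fintype_card]
  rfl

end Counting

end FanoClassification

theorem mainTheorem4 :
    -- there are exactly 28 four-dimensional Fano polyhedra with 7 vertices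
    Nat.card (FanoClassification.IsoClass 4 7) = 28 ∧
    -- they have exactly three combinatorial types `D`, `E`, `G`
    (∀ P : FanoClassification.FanoPolyhedron 4 7,
      ∃! t : FanoClassification.CombType, FanoClassification.HasType P t) ∧
    (∀ (P Q : FanoClassification.FanoPolyhedron 4 7) (t : FanoClassification.CombType),
      FanoClassification.HasType P t →
        (FanoClassification.CombinatoriallyEquivalent P Q ↔ FanoClassification.HasType Q t)) ∧
    -- the number of polyhedra of each type
    (FanoClassification.classesOfType .D).ncard = 19 ∧
    (FanoClassification.classesOfType .E).ncard = 3 ∧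
    (FanoClassification.classesOfType .G).ncard = 6 ∧
    -- each listed system of primitive relations defines exactly one polyhedron, of the type
    -- indicated by its name, and every polyhedron is listed exactly once
    (∀ a : FanoClassification.Name, ∃ P : FanoClassification.FanoPolyhedron 4 7,
      FanoClassification.DescribedBy P a) ∧
    (∀ (P : FanoClassification.FanoPolyhedron 4 7) (a : FanoClassification.Name),
      FanoClassification.DescribedBy P a → FanoClassification.HasType P a.type) ∧
    (∀ P : FanoClassification.FanoPolyhedron 4 7,
      ∃! a : FanoClassification.Name, FanoClassification.DescribedBy P a) ∧
    (∀ (P Q : FanoClassification.FanoPolyhedron 4 7) (a b : FanoClassification.Name),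
      FanoClassification.DescribedBy P a → FanoClassification.DescribedBy Q b →
        (FanoClassification.Isomorphic P Q ↔ a = b)) := by
  exact ⟨FanoClassification.card_isoClass, FanoClassification.existsUnique_hasType,
    fun _ _ _ h => h.combinatoriallyEquivalent_iff,
    (FanoClassification.ncard_classesOfType .D).trans rfl,
    (FanoClassification.ncard_classesOfType .E).trans rfl,
    (FanoClassification.ncard_classesOfType .G).trans rfl,
    FanoClassification.exists_describedBy, fun _ _ h => h.hasType,
    FanoClassification.existsUnique_describedBy, fun _ _ _ _ h h' => h.isomorphic_iff h'⟩
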